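/- For real $\alpha,\beta,\gamma$ and an integer $n\ge 0$ let $Lp_n(\alpha,\beta,\gamma)=(k_{ij})_{1\le i,j\le n+1}$ be the lattice path matrix given by $k_{1j}=\alpha^{j-1}$, $k_{i1}=\beta^{i-1}$ and $k_{ij}=\alpha k_{i,j-1}+\beta k_{i-1,j}+\gamma k_{i-1,j-1}$ for $2\le i,j\le n+1$. *Conventions.* A matrix is strictly totally positive (STP) if all its minors are positive. For an $N\times N$ matrix $B$, let $F_k$ be the unit lower bidiagonal matrix whose $(i,i-1)$ entry is $B_{i,i-k}$ for $i\ge k+1$ and $0$ for $i\le k$, let $G_k$ be the unit upper bidiagonal matrix whose $(i-1,i)$ entry is $B_{i-k,i}$ for $i\ge k+1$ and $0$ for $i\le k$, and let $D=\mathrm{diag}(B_{11},\dots,B_{NN})$. We write $B=\mathcal{BD}(A)$ (the bidiagonal decomposition of $A$) if $A=F_{N-1}\cdots F_1\,D\,G_1\cdots G_{N-1}$, where $B_{ii}>0$, $B_{ij}\ge0$ for $i\neq j$, and for $j<i<h$, $B_{ij}=0$ implies $B_{hj}=0$ and $B_{ji}=0$ implies $B_{jh}=0$. Computations are carried out by programs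 (sequences of instructions, conditionals and loops over real registers, with operations $+,-,\times,\div,\sqrt{\ }$, comparisons, and the constants $0$, $1$ and the unit round-off $u$), run in a floating point arithmetic with unit round-off $u$ in which every operation returns its exact result with relative error at most $u$; input data are exact. Quantities $x_k$ (depending on the data) are computed *to high relative accuracy* (HRA) by a program if there are constants $K,u_0>0$, independent of $u$, of the arithmetic and of the data, such that for all $0<u\le u_0$ and all such arithmetics the program terminates and its outputs $\tilde x_k$ satisfy $|x_k-\tilde x_k|\le K u\,|x_k|$. **Statement.** Fix $n$. (1) If $\alpha,\beta>0$ and $\alpha\beta+\gamma>0$, then $Lp_n(\alpha,\beta,\gamma)$ is STP, and its bidiagonal decomposition is $$\mathcal{BD}(Lp_n(\alpha,\beta,\gamma))_{ij}=\begin{cases}(\alpha\beta+\gamma)^{i-1},& i=j,\\ \beta,& i>j,\\ \alpha,& i<j.\end{cases}$$ (2) There is a straight-line, subtraction-free program (its only arithmetic operations are sums, products and quotients) which, for all $\alpha,\beta>0$ and $\gamma\ge0$, computes $\mathcal{BD}(Lp_n(\alpha,\beta,\gamma))$ from $\alpha,\beta,\gamma$ to HRA. Moreover there are programs which, taking the computed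 bidiagonal decomposition as input, compute to HRA, for all $\alpha,\beta>0$ and $\gamma\ge0$: the eigenvalues of $Lp_n(\alpha,\beta,\gamma)$ (all of which are real), its singular values, the entries of its inverse, and, given additionally a vector $b=(b_1,\dots,b_{n+1})$ with alternating signs (either $(-1)^i b_i\ge 0$ for all $i$ or $(-1)^i b_i\le0$ for all $i$), the solution $x$ of $Lp_n(\alpha,\beta,\gamma)x=b$. The constants $K,u_0$ depend only on $n$. -/

import Mathlib

namespace LatticePath

/-! ### Strictly total positivity, lattice path matrices, bidiagonal decompositions -/

/-- A square matrix is strictly totally positive (STP) if all its minors are positive. -/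
def IsSTP {N : ℕ} (A : Matrix (Fin N) (Fin N) ℝ) : Prop :=
  ∀ (k : ℕ) (r c : Fin k ↪o Fin N), 0 < (A.submatrix r c).det

/-- The array `k_{i+1,j+1}` (indices shifted to start at `0`) defined by
`k_{1j} = α^(j-1)`, `k_{i1} = β^(i-1)` and
`k_{ij} = α k_{i,j-1} + β k_{i-1,j} + γ k_{i-1,j-1}`. -/
def entry (α β γ : ℝ) : ℕ → ℕ → ℝ
  | 0, j => α ^ j
  | i + 1, 0 => β ^ (i + 1)
  | i + 1, j + 1 => α * entry α β γ (i + 1) j + β * entry α β γ i (j + 1) + γ * entry α β γ i j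

/-- The `(n+1) × (n+1)` lattice path matrix `Lp_n(α, β, γ)`. -/
def Lp (n : ℕ) (α β γ : ℝ) : Matrix (Fin (n + 1)) (Fin (n + 1)) ℝ :=
  Matrix.of fun i j => entry α β γ i j

/-- The unit lower bidiagonal matrix `F_k` built from the part of `B` below the diagonal: with
1-based indices its `(i, i-1)` entry is `m_{i,i-k} = B_{i,i-k}` for `i ≥ k + 1`, and `0` for
`i ≤ k`. -/
def lowerFactor {N : ℕ} (B : Matrix (Fin N) (Fin N) ℝ) (k : ℕ) : Matrix (Fin N) (Fin N) ℝ :=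
  Matrix.of fun i j =>
    if i = j then 1
    else if (i : ℕ) = j + 1 ∧ k ≤ (i : ℕ) then
      B i ⟨(i : ℕ) - k, lt_of_le_of_lt (Nat.sub_le _ _) i.2⟩
    else 0

/-- The unit upper bidiagonal matrix `G_k` built from the part of `B` above the diagonal: with
1-based indices its `(i-1, i)` entry is `m̃_{i,i-k} = B_{i-k,i}` for `i ≥ k + 1`. -/
def upperFactor {N : ℕ} (B : Matrix (Fin N) (Fin N) ℝ) (k : ℕ) : Matrix (Fin N) (Fin N) ℝ :=
  (lowerFactor B.transpose k).transpose

/-- `F_k F_{k-1} ⋯ F_1`. -/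
def lowerProd {N : ℕ} (B : Matrix (Fin N) (Fin N) ℝ) : ℕ → Matrix (Fin N) (Fin N) ℝ
  | 0 => 1
  | k + 1 => lowerFactor B (k + 1) * lowerProd B k

/-- `G_1 G_2 ⋯ G_k`. -/
def upperProd {N : ℕ} (B : Matrix (Fin N) (Fin N) ℝ) : ℕ → Matrix (Fin N) (Fin N) ℝ
  | 0 => 1
  | k + 1 => upperProd B k * upperFactor B (k + 1)

/-- `B = BD(A)`: the matrix `B` stores the bidiagonal decomposition
`A = F_{N-1} ⋯ F_1 D G_1 ⋯ G_{N-1}` of the `N × N` matrix `A`, where `D` is the diagonal of `B`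
(positive pivots), the nonnegative multipliers `m_{ij} = B_{ij}` (`i > j`) fill the `F_k`, the
nonnegative multipliers `m̃_{ij} = B_{ji}` (`i > j`) fill the `G_k`, and the normalisation
`m_{ij} = 0 → m_{hj} = 0` for `h > i` holds for both families. -/
structure IsBidiagonalDecomposition {N : ℕ} (A B : Matrix (Fin N) (Fin N) ℝ) : Prop where
  factorization :
    A = lowerProd B (N - 1) * Matrix.diagonal (fun i => B i i) * upperProd B (N - 1)
  pivot_pos : ∀ i, 0 < B i i
  multiplier_nonneg : ∀ i j, i ≠ j → 0 ≤ B i j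
  lower_zero : ∀ i j h, j < i → i < h → B i j = 0 → B h j = 0
  upper_zero : ∀ i j h, j < i → i < h → B j i = 0 → B j h = 0

/-- The array with `(i,i)` entry `(αβ+γ)^(i-1)` (1-based), `β` below and `α` above the diagonal. -/
def latticeBD (n : ℕ) (α β γ : ℝ) : Matrix (Fin (n + 1)) (Fin (n + 1)) ℝ :=
  Matrix.of fun i j => if i = j then (α * β + γ) ^ (i : ℕ) else if j < i then β else α

/-- The signs of `b` alternate (zero entries are allowed). -/
def AlternatingSigns {N : ℕ} (b : Fin N → ℝ) : Prop :=
  (∀ i : Fin N, 0 ≤ (-1) ^ (i : ℕ) * b i) ∨ (∀ i : Fin N, (-1) ^ (i : ℕ) * b i ≤ 0)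

/-! ### Floating point arithmetic and programs -/

/-- Arithmetic obeying the standard model of floating point arithmetic with unit round-off `u`:
every operation returns its exact result up to a relative error of at most `u`. -/
structure FloatArith (u : ℝ) where
  add : ℝ → ℝ → ℝ
  sub : ℝ → ℝ → ℝ
  mul : ℝ → ℝ → ℝ
  div : ℝ → ℝ → ℝ
  sqrt : ℝ → ℝ
  add_err : ∀ x y, |add x y - (x + y)| ≤ u * |x + y|
  sub_err : ∀ x y, |sub x y - (x - y)| ≤ u * |x - y|
  mul_err : ∀ x y, |mul x y - x * y| ≤ u * |x * y|
  div_err : ∀ x y, y ≠ 0 → |div x y - x / y| ≤ u * |x / y|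
  sqrt_err : ∀ x, 0 ≤ x → |sqrt x - Real.sqrt x| ≤ u * |Real.sqrt x|

/-- The registers of a machine with inputs indexed by `ι` and outputs indexed by `κ`. -/
inductive Reg (ι κ : Type) where
  | input (i : ι)
  | output (k : κ)
  | scratch (m : ℕ)

/-- Programs. The first argument `d` of an instruction is the register that receives the result.
The only constants a program can load are `1` and the unit round-off of the machine (and `0`, the
initial value of every register that is not an input). `ite a b p q` and `while a b p` test whether
the content of `a` is smaller than that of `b`. -/
inductive Program (ι κ : Type) where
  | skip
  | one (d : Reg ι κ)
  | unitRoundoff (d : Reg ι κ)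
  | copy (d a : Reg ι κ)
  | add (d a b : Reg ι κ)
  | sub (d a b : Reg ι κ)
  | mul (d a b : Reg ι κ)
  | div (d a b : Reg ι κ)
  | sqrt (d a : Reg ι κ)
  | seq (p q : Program ι κ)
  | ite (a b : Reg ι κ) (p q : Program ι κ)
  | while (a b : Reg ι κ) (p : Program ι κ)

/-- Contents of the registers. -/
abbrev Store (ι κ : Type) := Reg ι κ → ℝ

open Classical in
/-- The store `s` with the content of `d` replaced by `v`. -/
noncomputable def Store.set {ι κ : Type} (s : Store ι κ) (d : Reg ι κ) (v : ℝ) : Store ι κ :=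
  fun r => if r = d then v else s r

/-- `Exec F p s t`: the program `p`, run in the arithmetic `F` from the store `s`, terminates in the
store `t`. A division by zero or a square root of a negative number has no execution. -/
inductive Exec {ι κ : Type} {u : ℝ} (F : FloatArith u) :
    Program ι κ → Store ι κ → Store ι κ → Prop where
  | skip (s) : Exec F .skip s s
  | one (d s) : Exec F (.one d) s (s.set d 1)
  | unitRoundoff (d s) : Exec F (.unitRoundoff d) s (s.set d u)
  | copy (d a s) : Exec F (.copy d a) s (s.set d (s a))
  | add (d a b s) : Exec F (.add d a b) s (s.set d (F.add (s a) (s b)))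
  | sub (d a b s) : Exec F (.sub d a b) s (s.set d (F.sub (s a) (s b)))
  | mul (d a b s) : Exec F (.mul d a b) s (s.set d (F.mul (s a) (s b)))
  | div (d a b s) : s b ≠ 0 → Exec F (.div d a b) s (s.set d (F.div (s a) (s b)))
  | sqrt (d a s) : 0 ≤ s a → Exec F (.sqrt d a) s (s.set d (F.sqrt (s a)))
  | seq (p q s t r) : Exec F p s t → Exec F q t r → Exec F (.seq p q) s r
  | iteTrue (a b p q s t) : s a < s b → Exec F p s t → Exec F (.ite a b p q) s t
  | iteFalse (a b p q s t) : ¬ s a < s b → Exec F q s t → Exec F (.ite a b p q) s t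
  | whileDone (a b p s) : ¬ s a < s b → Exec F (.while a b p) s s
  | whileStep (a b p s t r) : s a < s b → Exec F p s t → Exec F (.while a b p) t r →
      Exec F (.while a b p) s r

/-- Execution is deterministic: a program has at most one final store. -/
theorem Exec.deterministic {ι κ : Type} {u : ℝ} {F : FloatArith u} {p : Program ι κ}
    {s t t' : Store ι κ} (h : Exec F p s t) (h' : Exec F p s t') : t = t' := by
  induction h generalizing t' with
  | seq p q s t r _ _ ih₁ ih₂ =>
    cases h' with
    | seq _ _ _ t₂ _ h₁ h₂ => obtain rfl := ih₁ h₁; exact ih₂ h₂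
  | iteTrue a b p q s t hc _ ih =>
    cases h' with
    | iteTrue _ _ _ _ _ _ _ h₁ => exact ih h₁
    | iteFalse _ _ _ _ _ _ hn _ => exact absurd hc hn
  | iteFalse a b p q s t hc _ ih =>
    cases h' with
    | iteTrue _ _ _ _ _ _ hn _ => exact absurd hn hc
    | iteFalse _ _ _ _ _ _ _ h₁ => exact ih h₁
  | whileDone a b p s hc =>
    cases h' with
    | whileDone => rfl
    | whileStep _ _ _ _ _ _ hn _ _ => exact absurd hn hc
  | whileStep a b p s t r hc _ _ ih₁ ih₂ =>
    cases h' with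
    | whileDone _ _ _ _ hn => exact absurd hc hn
    | whileStep _ _ _ _ t₂ _ _ h₁ h₂ => obtain rfl := ih₁ h₁; exact ih₂ h₂
  | _ => cases h'; rfl

namespace Program

/-- The initial store: the input registers hold `x`, all other registers hold `0`. -/
def initStore {ι κ : Type} (x : ι → ℝ) : Store ι κ
  | .input i => x i
  | .output _ => 0
  | .scratch _ => 0

/-- In the arithmetic `F` and on input `x` the program terminates with output `y`. -/
def Computes {ι κ : Type} {u : ℝ} (p : Program ι κ) (F : FloatArith u) (x : ι → ℝ)
    (y : κ → ℝ) : Prop :=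
  ∃ t, Exec F p (initStore x) t ∧ ∀ k, t (.output k) = y k

/-- On input `x` the program terminates, and each number it computes approximates the corresponding
component of `z` with a relative error of at most `ε`. -/
def ComputesWithin {ι κ : Type} {u : ℝ} (p : Program ι κ) (F : FloatArith u) (x : ι → ℝ)
    (ε : ℝ) (z : κ → ℝ) : Prop :=
  ∃ y, p.Computes F x y ∧ ∀ k, |z k - y k| ≤ ε * |z k|

/-- Straight-line programs whose only arithmetic operations are sums, products and quotients. On
nonnegative inputs they only add numbers of the same sign. -/
def SubtractionFree {ι κ : Type} : Program ι κ → Prop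
  | .skip => True
  | .one _ => True
  | .copy _ _ => True
  | .add _ _ _ => True
  | .mul _ _ _ => True
  | .div _ _ _ => True
  | .seq p q => p.SubtractionFree ∧ q.SubtractionFree
  | _ => False

end Program

end LatticePath

namespace LatticePath

/-! ### Arithmetic expressions and their compilation to programs -/

/-! Put `q = αβ + γ`. The recurrence is solved by `k_{i+1,j+1} = ∑ₖ C(i,k) β^(i-k) q^k C(j,k)
α^(j-k)` (`entry_eq_sum`), so `Lp_n` is a scaled Pascal matrix in `β`, times `diag(q^k)`, times the
transpose of one in `α`. A scaled Pascal matrix is a product of `n` bidiagonal matrices with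
constant multiplier (`lowerProd_latticeBD`), which gives the bidiagonal decomposition. Cauchy–Binet
then writes each minor of `Lp_n` as monomials in `α`, `β` times a polynomial in `q/(αβ)` whose
coefficients are products of Pascal minors, hence natural numbers (`compound_Lp`). The initial
Pascal minors are positive by Vandermonde, so all minors of `Lp_n` are positive.

For accuracy, errors are measured as `log(computed/exact)`. On this scale products and quotients add
errors, square roots halve them, and sums of terms of one sign do not exceed the larger one. An
expression without cancellation is therefore computed with error `O(u)`, even from data already
perturbed by `O(u)` (`near_fl`, `err_smul`). The entries of the bidiagonal decomposition, all minors
and the absolute values of the entries of the inverse are of this kind; the inverse has checkerboard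
signs, so a right-hand side with alternating signs causes no cancellation either.

Eigenvalues are reached through minors. `Lp_n` is diagonally similar to some `RᵀR`, so its
eigenvalues `d₁ ≥ d₂ ≥ ⋯` are positive. The trace of the `m`-th power of the `k`-th compound is the
sum of the `m`-th powers of all `k`-fold eigenvalue products, hence lies between `(d₁⋯d_k)^m` and a
constant `C` times that. Take `m = 2^p ≥ 1/u`: the `p` squarings inflate the error to `O(2^p u)`,
the `p` square roots deflate it to `O(u)`, and the factor `C` leaves only `log C / 2^p ≤ u log C`.
Quotients of consecutive results are the eigenvalues (`exists_near_rootProgram`). Singular values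
come from the same program applied to the Gram matrix, with one more root. -/

/-- Arithmetic expressions in variables indexed by `V`. -/
inductive Ex (V : Type) where
  | zero
  | one
  | unit
  | var (v : V)
  | add (a b : Ex V)
  | mul (a b : Ex V)
  | div (a b : Ex V)
  | neg (a : Ex V)
  | sqrt (a : Ex V)

namespace Ex

variable {V ι κ : Type} {u : ℝ}

/-- The value of an expression in floating point arithmetic. -/
noncomputable def fl (F : FloatArith u) (x : V → ℝ) : Ex V → ℝ
  | zero => 0
  | one => 1
  | unit => u
  | var v => x v
  | add a b => F.add (a.fl F x) (b.fl F x)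
  | mul a b => F.mul (a.fl F x) (b.fl F x)
  | div a b => F.div (a.fl F x) (b.fl F x)
  | neg a => F.sub 0 (a.fl F x)
  | sqrt a => F.sqrt (a.fl F x)

/-- The floating point evaluation meets no division by zero and no root of a negative number. -/
def Defined (F : FloatArith u) (x : V → ℝ) : Ex V → Prop
  | zero => True
  | one => True
  | unit => True
  | var _ => True
  | add a b => a.Defined F x ∧ b.Defined F x
  | mul a b => a.Defined F x ∧ b.Defined F x
  | div a b => a.Defined F x ∧ b.Defined F x ∧ b.fl F x ≠ 0
  | neg a => a.Defined F x
  | sqrt a => a.Defined F x ∧ 0 ≤ a.fl F x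

/-- Expressions built with sums, products and quotients only. -/
def SubtractionFree : Ex V → Prop
  | zero => True
  | one => True
  | unit => False
  | var _ => True
  | add a b => a.SubtractionFree ∧ b.SubtractionFree
  | mul a b => a.SubtractionFree ∧ b.SubtractionFree
  | div a b => a.SubtractionFree ∧ b.SubtractionFree
  | neg _ => False
  | sqrt _ => False

/-- A program that leaves the value of the expression in scratch register `m`, using only the
scratch registers from `m` on. Scratch register `0` holds `0`. -/
def compile (loc : V → Reg ι κ) : Ex V → ℕ → Program ι κ
  | zero, m => .copy (.scratch m) (.scratch 0)
  | one, m => .one (.scratch m)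
  | unit, m => .unitRoundoff (.scratch m)
  | var v, m => .copy (.scratch m) (loc v)
  | add a b, m => .seq (a.compile loc m) (.seq (b.compile loc (m + 1))
      (.add (.scratch m) (.scratch m) (.scratch (m + 1))))
  | mul a b, m => .seq (a.compile loc m) (.seq (b.compile loc (m + 1))
      (.mul (.scratch m) (.scratch m) (.scratch (m + 1))))
  | div a b, m => .seq (a.compile loc m) (.seq (b.compile loc (m + 1))
      (.div (.scratch m) (.scratch m) (.scratch (m + 1))))
  | neg a, m => .seq (a.compile loc m) (.sub (.scratch m) (.scratch 0) (.scratch m))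
  | sqrt a, m => .seq (a.compile loc m) (.sqrt (.scratch m) (.scratch m))

theorem subtractionFree_compile (loc : V → Reg ι κ) (e : Ex V) (he : e.SubtractionFree) (m : ℕ) :
    (e.compile loc m).SubtractionFree := by
  induction e generalizing m with
  | zero | one | var => trivial
  | unit | neg | sqrt => exact he.elim
  | add a b iha ihb | mul a b iha ihb | div a b iha ihb =>
    exact ⟨iha he.1 m, ihb he.2 (m + 1), trivial⟩

end Ex

theorem Store.set_self {ι κ : Type} (s : Store ι κ) (d : Reg ι κ) (v : ℝ) : s.set d v d = v := by
  simp [Store.set]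

theorem Store.set_of_ne {ι κ : Type} (s : Store ι κ) {d r : Reg ι κ} (v : ℝ) (h : r ≠ d) :
    s.set d v r = s r := by
  simp [Store.set, h]

/-- The stores agree outside the scratch registers from `m` on. -/
def AgreeBelow {ι κ : Type} (m : ℕ) (s t : Store ι κ) : Prop :=
  ∀ r, (∀ j, m ≤ j → r ≠ .scratch j) → t r = s r

namespace AgreeBelow

variable {ι κ : Type} {m m' : ℕ} {s t r : Store ι κ}

theorem trans (h : AgreeBelow m s t) (h' : AgreeBelow m' t r) (hm : m ≤ m') : AgreeBelow m s r :=
  fun a ha => (h' a fun j hj => ha j (hm.trans hj)).trans (h a ha)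

theorem set (h : AgreeBelow m s t) (v : ℝ) : AgreeBelow m s (t.set (.scratch m) v) :=
  fun a ha => (Store.set_of_ne _ _ (ha m le_rfl)).trans (h a ha)

theorem scratch (h : AgreeBelow m s t) {j : ℕ} (hj : j < m) : t (.scratch j) = s (.scratch j) :=
  h _ fun i hi e => by injection e with e; omega

theorem refl (m : ℕ) (s : Store ι κ) : AgreeBelow m s s := fun _ _ => rfl

end AgreeBelow

/-- Registers that are not scratch registers from `m` on. -/
def IsBelow {ι κ : Type} (m : ℕ) (r : Reg ι κ) : Prop := ∀ j, m ≤ j → r ≠ .scratch j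

theorem IsBelow.mono {ι κ : Type} {m m' : ℕ} {r : Reg ι κ} (h : IsBelow m r) (hm : m ≤ m') :
    IsBelow m' r := fun j hj => h j (hm.trans hj)

namespace Ex

variable {V W ι κ : Type} {u : ℝ}

/-- The scratch registers from `m` on act as a stack: the second operand is evaluated from `m + 1`
upwards and so leaves the first one, in `m`, intact. -/
theorem exec_compile (F : FloatArith u) (loc : V → Reg ι κ) (x : V → ℝ) (e : Ex V) (m : ℕ)
    (hm : 1 ≤ m) (hloc : ∀ v, IsBelow m (loc v)) (s : Store ι κ) (hs : s (.scratch 0) = 0)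
    (hx : ∀ v, s (loc v) = x v) (hd : e.Defined F x) :
    ∃ t, Exec F (e.compile loc m) s t ∧ t (.scratch m) = e.fl F x ∧ AgreeBelow m s t := by
  have binary : ∀ (a b : Ex V),
      (∀ (m : ℕ), 1 ≤ m → (∀ v, IsBelow m (loc v)) → ∀ s : Store ι κ, s (.scratch 0) = 0 →
        (∀ v, s (loc v) = x v) → a.Defined F x →
        ∃ t, Exec F (a.compile loc m) s t ∧ t (.scratch m) = a.fl F x ∧ AgreeBelow m s t) →
      (∀ (m : ℕ), 1 ≤ m → (∀ v, IsBelow m (loc v)) → ∀ s : Store ι κ, s (.scratch 0) = 0 →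
        (∀ v, s (loc v) = x v) → b.Defined F x →
        ∃ t, Exec F (b.compile loc m) s t ∧ t (.scratch m) = b.fl F x ∧ AgreeBelow m s t) →
      ∀ (m : ℕ), 1 ≤ m → (∀ v, IsBelow m (loc v)) → ∀ s : Store ι κ, s (.scratch 0) = 0 →
        (∀ v, s (loc v) = x v) → a.Defined F x → b.Defined F x →
        ∃ t r, Exec F (a.compile loc m) s t ∧ Exec F (b.compile loc (m + 1)) t r ∧
          r (.scratch m) = a.fl F x ∧ r (.scratch (m + 1)) = b.fl F x ∧ AgreeBelow m s r := by
    intro a b iha ihb m hm hloc s hs hx ha hb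
    obtain ⟨t, ht, hta, hst⟩ := iha m hm hloc s hs hx ha
    obtain ⟨r, hr, hrb, htr⟩ := ihb (m + 1) (by omega) (fun v => (hloc v).mono (by omega)) t
      ((hst.scratch (by omega)).trans hs) (fun v => (hst _ (hloc v)).trans (hx v)) hb
    exact ⟨t, r, ht, hr, (htr.scratch (by omega)).trans hta, hrb, hst.trans htr (by omega)⟩
  induction e generalizing m s with
  | zero => exact ⟨_, .copy _ _ _, (Store.set_self _ _ _).trans hs, (AgreeBelow.refl m s).set _⟩
  | one => exact ⟨_, .one _ _, Store.set_self _ _ _, (AgreeBelow.refl m s).set _⟩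
  | unit => exact ⟨_, .unitRoundoff _ _, Store.set_self _ _ _, (AgreeBelow.refl m s).set _⟩
  | var v =>
    exact ⟨_, .copy _ _ _, (Store.set_self _ _ _).trans (hx v), (AgreeBelow.refl m s).set _⟩
  | add a b iha ihb =>
    obtain ⟨t, r, h₁, h₂, ha, hb, h⟩ := binary a b iha ihb m hm hloc s hs hx hd.1 hd.2
    exact ⟨_, .seq _ _ _ _ _ h₁ (.seq _ _ _ _ _ h₂ (.add _ _ _ _)),
      by rw [Store.set_self, ha, hb]; rfl, h.set _⟩
  | mul a b iha ihb =>
    obtain ⟨t, r, h₁, h₂, ha, hb, h⟩ := binary a b iha ihb m hm hloc s hs hx hd.1 hd.2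
    exact ⟨_, .seq _ _ _ _ _ h₁ (.seq _ _ _ _ _ h₂ (.mul _ _ _ _)),
      by rw [Store.set_self, ha, hb]; rfl, h.set _⟩
  | div a b iha ihb =>
    obtain ⟨t, r, h₁, h₂, ha, hb, h⟩ := binary a b iha ihb m hm hloc s hs hx hd.1 hd.2.1
    exact ⟨_, .seq _ _ _ _ _ h₁ (.seq _ _ _ _ _ h₂ (.div _ _ _ _ (by rw [hb]; exact hd.2.2))),
      by rw [Store.set_self, ha, hb]; rfl, h.set _⟩
  | neg a iha =>
    obtain ⟨t, h₁, ha, h⟩ := iha m hm hloc s hs hx hd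
    exact ⟨_, .seq _ _ _ _ _ h₁ (.sub _ _ _ _),
      by rw [Store.set_self, ha, h.scratch (by omega), hs]; rfl, h.set _⟩
  | sqrt a iha =>
    obtain ⟨t, h₁, ha, h⟩ := iha m hm hloc s hs hx hd.1
    exact ⟨_, .seq _ _ _ _ _ h₁ (.sqrt _ _ _ (by rw [ha]; exact hd.2)),
      by rw [Store.set_self, ha]; rfl, h.set _⟩

/-! ### Simultaneous assignment. -/

/-- Evaluate the expressions `e w` for `w` in a list into scratch registers `m, m + 1, …`. -/
def compileList (loc : V → Reg ι κ) (e : W → Ex V) : List W → ℕ → Program ι κ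
  | [], _ => .skip
  | w :: l, m => .seq ((e w).compile loc m) (compileList loc e l (m + 1))

/-- Copy the scratch registers `m, m + 1, …` to the registers `dst w` for `w` in a list. -/
def moveList (dst : W → Reg ι κ) : List W → ℕ → Program ι κ
  | [], _ => .skip
  | w :: l, m => .seq (.copy (dst w) (.scratch m)) (moveList dst l (m + 1))

theorem exec_compileList (F : FloatArith u) (loc : V → Reg ι κ) (x : V → ℝ) (e : W → Ex V)
    (l : List W) (m : ℕ) (hm : 1 ≤ m) (hloc : ∀ v, IsBelow m (loc v)) (s : Store ι κ)
    (hs : s (.scratch 0) = 0) (hx : ∀ v, s (loc v) = x v) (hd : ∀ w, (e w).Defined F x) :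
    ∃ t, Exec F (compileList loc e l m) s t ∧ AgreeBelow m s t ∧
      ∀ i (h : i < l.length), t (.scratch (m + i)) = (e l[i]).fl F x := by
  induction l generalizing m s with
  | nil => exact ⟨s, .skip _, .refl _ _, fun i h => by simp at h⟩
  | cons w l ih =>
    obtain ⟨t, ht, htw, hst⟩ := exec_compile F loc x (e w) m hm hloc s hs hx (hd w)
    obtain ⟨r, hr, htr, hl⟩ := ih (m + 1) (by omega) (fun v => (hloc v).mono (by omega)) t
      ((hst.scratch (by omega)).trans hs) (fun v => (hst _ (hloc v)).trans (hx v))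
    refine ⟨r, .seq _ _ _ _ _ ht hr, hst.trans htr (by omega), fun i h => ?_⟩
    cases i with
    | zero => exact (htr.scratch (by omega)).trans htw
    | succ i =>
      have := hl i (by simpa using h)
      rw [show m + 1 + i = m + (i + 1) by omega] at this
      exact this

theorem exec_moveList (F : FloatArith u) (dst : W → Reg ι κ) (hinj : Function.Injective dst)
    (y : W → ℝ) (l : List W) (m : ℕ) (hdst : ∀ w, IsBelow m (dst w)) (s : Store ι κ)
    (hy : ∀ i (h : i < l.length), s (.scratch (m + i)) = y l[i]) :
    ∃ t, Exec F (moveList dst l m) s t ∧ (∀ w ∈ l, t (dst w) = y w) ∧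
      ∀ r, (∀ w, r ≠ dst w) → t r = s r := by
  -- The induction needs the frame condition relative to the list only: a destination written first
  -- must survive the rest of the moves unless it occurs there again.
  suffices h : ∃ t, Exec F (moveList dst l m) s t ∧ (∀ w ∈ l, t (dst w) = y w) ∧
      ∀ r, (∀ w ∈ l, r ≠ dst w) → t r = s r by
    obtain ⟨t, h₁, h₂, h₃⟩ := h
    exact ⟨t, h₁, h₂, fun r hr => h₃ r fun w _ => hr w⟩
  induction l generalizing m s with
  | nil => exact ⟨s, .skip _, by simp, fun _ _ => rfl⟩
  | cons w l ih =>
    obtain ⟨t, ht, hl, ho⟩ := ih (m + 1) (fun w => (hdst w).mono (by omega))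
      (s.set (dst w) (s (.scratch m))) (fun i h => by
        rw [Store.set_of_ne _ _ (fun h => hdst w _ (by omega) h.symm)]
        have := hy (i + 1) (by simpa using h)
        rw [show m + 1 + i = m + (i + 1) by omega]
        exact this)
    refine ⟨t, .seq _ _ _ _ _ (.copy _ _ _) ht, fun w' hw' => ?_, fun r hr => ?_⟩
    · by_cases hl' : w' ∈ l
      · exact hl w' hl'
      · obtain rfl : w' = w := by simpa [hl'] using hw'
        rw [ho _ fun v hv h => hl' (by rwa [hinj h]), Store.set_self]
        exact hy 0 (by simp)
    · rw [ho r fun v hv => hr v (by simp [hv]), Store.set_of_ne _ _ (hr w (by simp))]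

/-- The simultaneous assignment of the values of the expressions `e w` to the registers `dst w`. -/
noncomputable def assign [Fintype W] (loc : V → Reg ι κ) (e : W → Ex V) (dst : W → Reg ι κ)
    (m : ℕ) : Program ι κ :=
  .seq (compileList loc e (Finset.univ : Finset W).toList m)
    (moveList dst (Finset.univ : Finset W).toList m)

theorem subtractionFree_assign [Fintype W] (loc : V → Reg ι κ) (e : W → Ex V)
    (dst : W → Reg ι κ) (m : ℕ) (he : ∀ w, (e w).SubtractionFree) :
    (assign loc e dst m).SubtractionFree := by
  refine ⟨?_, ?_⟩
  · generalize (Finset.univ : Finset W).toList = l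
    induction l generalizing m with
    | nil => trivial
    | cons w l ih => exact ⟨subtractionFree_compile _ _ (he w) _, ih _⟩
  · generalize (Finset.univ : Finset W).toList = l
    induction l generalizing m with
    | nil => trivial
    | cons w l ih => exact ⟨trivial, ih _⟩

/-- All values are computed into scratch space before any destination is written, so destinations
may also be variables of the expressions. Injectivity of `dst` keeps the moves from overwriting each
other. -/
theorem exec_assign [Fintype W] (F : FloatArith u) (loc : V → Reg ι κ) (x : V → ℝ)
    (e : W → Ex V) (dst : W → Reg ι κ) (m : ℕ) (hm : 1 ≤ m) (hloc : ∀ v, IsBelow m (loc v))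
    (hinj : Function.Injective dst) (hdst : ∀ w, IsBelow m (dst w)) (s : Store ι κ)
    (hs : s (.scratch 0) = 0) (hx : ∀ v, s (loc v) = x v) (hd : ∀ w, (e w).Defined F x) :
    ∃ t, Exec F (assign loc e dst m) s t ∧ (∀ w, t (dst w) = (e w).fl F x) ∧
      ∀ r, IsBelow m r → (∀ w, r ≠ dst w) → t r = s r := by
  obtain ⟨t, ht, hst, hv⟩ :=
    exec_compileList F loc x e (Finset.univ : Finset W).toList m hm hloc s hs hx hd
  obtain ⟨r, hr, hdr, ho⟩ := exec_moveList F dst hinj (fun w => (e w).fl F x)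
    (Finset.univ : Finset W).toList m hdst t hv
  exact ⟨r, .seq _ _ _ _ _ ht hr, fun w => hdr w (by simp), fun a ha ha' =>
    (ho a ha').trans (hst a ha)⟩

/-- The straight-line program that evaluates one expression for each output. -/
noncomputable def straightLine [Fintype κ] (e : κ → Ex ι) : Program ι κ :=
  assign .input e .output 1

theorem computes_straightLine [Fintype κ] (F : FloatArith u) (e : κ → Ex ι) (x : ι → ℝ)
    (hd : ∀ k, (e k).Defined F x) :
    (straightLine e).Computes F x fun k => (e k).fl F x := by
  obtain ⟨t, ht, h, -⟩ := exec_assign F .input x e (.output : κ → Reg ι κ) 1 le_rfl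
    (fun v j _ h => by cases h) (fun _ _ h => by injection h) (fun v j _ h => by cases h)
    (Program.initStore x) rfl (fun _ => rfl) hd
  exact ⟨t, ht, h⟩

end Ex

/-! ### Machines with a finite set of state variables -/

section Machine

variable {V ι κ : Type} [Fintype V] {u : ℝ}

/-- The scratch register that holds a state variable. -/
noncomputable def slot (v : V) : Reg ι κ := .scratch (1 + Fintype.equivFin V v)

/-- The register that holds an input or a state variable. -/
noncomputable def place : ι ⊕ V → Reg ι κ := Sum.elim .input slot

/-- The store `s` holds the input `x` and the state `y`. -/
structure Holds (s : Store ι κ) (x : ι → ℝ) (y : V → ℝ) : Prop where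
  zero : s (.scratch 0) = 0
  input : ∀ i, s (.input i) = x i
  state : ∀ v, s (slot v) = y v

theorem isBelow_slot (v : V) : IsBelow (1 + Fintype.card V) (slot v : Reg ι κ) := fun j hj h => by
  have := (Fintype.equivFin V v).2
  injection h with h
  omega

theorem isBelow_place (v : ι ⊕ V) : IsBelow (1 + Fintype.card V) (place v : Reg ι κ) := by
  cases v with
  | inl i => intro j _ h; cases h
  | inr v => exact isBelow_slot v

theorem slot_injective : Function.Injective (slot : V → Reg ι κ) := fun v w h => by
  injection h with h
  exact (Fintype.equivFin V).injective (Fin.ext (by omega))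

theorem Holds.place {s : Store ι κ} {x : ι → ℝ} {y : V → ℝ} (h : Holds s x y) (v : ι ⊕ V) :
    s (place v) = Sum.elim x y v := by
  cases v with
  | inl i => exact h.input i
  | inr v => exact h.state v

/-- The program that updates all state variables simultaneously. -/
noncomputable def update (e : V → Ex (ι ⊕ V)) : Program ι κ :=
  Ex.assign place e slot (1 + Fintype.card V)

theorem exec_update (F : FloatArith u) (e : V → Ex (ι ⊕ V)) {s : Store ι κ} {x : ι → ℝ}
    {y : V → ℝ} (h : Holds s x y) (hd : ∀ v, (e v).Defined F (Sum.elim x y)) :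
    ∃ t, Exec F (update e) s t ∧ Holds t x fun v => (e v).fl F (Sum.elim x y) := by
  obtain ⟨t, ht, hv, ho⟩ := Ex.exec_assign F place (Sum.elim x y) e slot (1 + Fintype.card V)
    (by omega) isBelow_place slot_injective isBelow_slot s h.zero h.place hd
  refine ⟨t, ht, ?_, fun i => ?_, hv⟩
  · rw [ho _ (fun j hj h => by injection h; omega) fun v h => by
      injection h; omega]
    exact h.zero
  · rw [ho _ (fun j hj h => by cases h) fun v h => by cases h]
    exact h.input i

/-- Termination is supplied from outside: the sequence of states `y` and the first index `p` at
which the test fails are given, and the induction shifts `y` by one. -/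
theorem exec_while_update (F : FloatArith u) (e : V → Ex (ι ⊕ V)) (a b : V) {x : ι → ℝ} (p : ℕ)
    (y : ℕ → V → ℝ) (hy : ∀ j v, y (j + 1) v = (e v).fl F (Sum.elim x (y j)))
    (hd : ∀ j < p, ∀ v, (e v).Defined F (Sum.elim x (y j))) (hlt : ∀ j < p, y j a < y j b)
    (hp : ¬ y p a < y p b) {s : Store ι κ} (h : Holds s x (y 0)) :
    ∃ t, Exec F (.while (slot a) (slot b) (update e)) s t ∧ Holds t x (y p) := by
  induction p generalizing y s with
  | zero => exact ⟨s, .whileDone _ _ _ _ (by rwa [h.state, h.state]), h⟩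
  | succ p ih =>
    obtain ⟨t, ht, hst⟩ := exec_update F e h (hd 0 (by omega))
    obtain ⟨r, hr, hrr⟩ := ih (fun j => y (j + 1)) (fun j v => hy (j + 1) v)
      (fun j hj => hd (j + 1) (by omega)) (fun j hj => hlt (j + 1) (by omega)) hp
      (s := t) (by
        have : y (0 + 1) = fun v => (e v).fl F (Sum.elim x (y 0)) := funext (hy 0)
        exact this ▸ hst)
    exact ⟨r, .whileStep _ _ _ _ _ _ (by rw [h.state, h.state]; exact hlt 0 (by omega)) ht hr,
      hrr⟩

theorem exec_output [Fintype κ] (F : FloatArith u) (e : κ → Ex (ι ⊕ V)) {s : Store ι κ}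
    {x : ι → ℝ} {y : V → ℝ} (h : Holds s x y) (hd : ∀ k, (e k).Defined F (Sum.elim x y)) :
    ∃ t, Exec F (Ex.assign place e .output (1 + Fintype.card V)) s t ∧
      ∀ k, t (.output k) = (e k).fl F (Sum.elim x y) := by
  obtain ⟨t, ht, hv, -⟩ := Ex.exec_assign F place (Sum.elim x y) e .output (1 + Fintype.card V)
    (by omega) isBelow_place (fun _ _ h => by injection h) (fun v j _ h => by cases h) s h.zero
    h.place hd
  exact ⟨t, ht, hv⟩

theorem holds_initStore (x : ι → ℝ) :
    Holds (Program.initStore x : Store ι κ) x (fun _ : V => (0 : ℝ)) :=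
  ⟨rfl, fun _ => rfl, fun _ => rfl⟩

end Machine

end LatticePath
namespace LatticePath

/-! ### Relative errors on a logarithmic scale -/

/-- `y` approximates `x` with a relative error of at most `ε` on a logarithmic scale. -/
def Near (ε x y : ℝ) : Prop := ∃ θ, |θ| ≤ ε ∧ y = x * Real.exp θ

namespace Near

variable {ε ε' x y z x' y' : ℝ}

theorem refl (x : ℝ) : Near 0 x x := ⟨0, by simp, by simp⟩

theorem mono (h : Near ε x y) (hε : ε ≤ ε') : Near ε' x y :=
  let ⟨θ, hθ, e⟩ := h
  ⟨θ, hθ.trans hε, e⟩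

theorem trans (h : Near ε x y) (h' : Near ε' y z) : Near (ε + ε') x z := by
  obtain ⟨θ, hθ, rfl⟩ := h
  obtain ⟨φ, hφ, rfl⟩ := h'
  exact ⟨θ + φ, (abs_add_le _ _).trans (add_le_add hθ hφ), by rw [Real.exp_add]; ring⟩

theorem eps_nonneg (h : Near ε x y) : 0 ≤ ε :=
  let ⟨_, hθ, _⟩ := h
  (abs_nonneg _).trans hθ

theorem ne_zero (h : Near ε x y) (hx : x ≠ 0) : y ≠ 0 := by
  obtain ⟨θ, -, rfl⟩ := h
  exact mul_ne_zero hx (Real.exp_ne_zero _)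

theorem nonneg (h : Near ε x y) (hx : 0 ≤ x) : 0 ≤ y := by
  obtain ⟨θ, -, rfl⟩ := h
  exact mul_nonneg hx (Real.exp_pos _).le

theorem mul (h : Near ε x y) (h' : Near ε' x' y') : Near (ε + ε') (x * x') (y * y') := by
  obtain ⟨θ, hθ, rfl⟩ := h
  obtain ⟨φ, hφ, rfl⟩ := h'
  exact ⟨θ + φ, (abs_add_le _ _).trans (add_le_add hθ hφ), by rw [Real.exp_add]; ring⟩

theorem div (h : Near ε x y) (h' : Near ε' x' y') : Near (ε + ε') (x / x') (y / y') := by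
  obtain ⟨θ, hθ, rfl⟩ := h
  obtain ⟨φ, hφ, rfl⟩ := h'
  exact ⟨θ - φ, (abs_sub _ _).trans (add_le_add hθ hφ), by rw [Real.exp_sub]; field_simp⟩

theorem neg (h : Near ε x y) : Near ε (-x) (-y) := by
  obtain ⟨θ, hθ, rfl⟩ := h
  exact ⟨θ, hθ, by ring⟩

theorem sqrt (h : Near ε x y) : Near (ε / 2) (√x) (√y) := by
  obtain ⟨θ, hθ, rfl⟩ := h
  refine ⟨θ / 2, by rw [abs_div, abs_two]; gcongr, ?_⟩
  rw [Real.sqrt_mul' _ (Real.exp_pos _).le, Real.exp_half]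

theorem of_bounds (hx : 0 < x) (h₁ : x * Real.exp (-ε) ≤ y) (h₂ : y ≤ x * Real.exp ε) :
    Near ε x y := by
  have hy : 0 < y := (mul_pos hx (Real.exp_pos _)).trans_le h₁
  refine ⟨Real.log (y / x), abs_le.2 ⟨?_, ?_⟩, ?_⟩
  · rw [Real.le_log_iff_exp_le (div_pos hy hx), le_div_iff₀ hx]
    linarith
  · rw [Real.log_le_iff_le_exp (div_pos hy hx), div_le_iff₀ hx]
    linarith
  · rw [Real.exp_log (div_pos hy hx)]
    field_simp

theorem bounds (h : Near ε x y) (hx : 0 ≤ x) :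
    x * Real.exp (-ε) ≤ y ∧ y ≤ x * Real.exp ε := by
  obtain ⟨θ, hθ, rfl⟩ := h
  obtain ⟨h₁, h₂⟩ := abs_le.1 hθ
  exact ⟨by gcongr, by gcongr⟩

theorem add_of_nonneg (hx : 0 ≤ x) (hx' : 0 ≤ x') (h : Near ε x y) (h' : Near ε x' y') :
    Near ε (x + x') (y + y') := by
  rcases hx.eq_or_lt with rfl | hp
  · obtain ⟨θ, -, rfl⟩ := h
    simpa using h'
  · have b := h.bounds hx
    have b' := h'.bounds hx'
    exact of_bounds (by linarith) (by nlinarith) (by nlinarith)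

/-- A sum of two numbers of the same sign is squeezed between the same exponential factors as its
summands, so the error does not grow. The sign condition `0 ≤ x * x'` is what excludes cancellation.
-/
theorem add (hx : 0 ≤ x * x') (h : Near ε x y) (h' : Near ε x' y') :
    Near ε (x + x') (y + y') := by
  rcases mul_nonneg_iff.1 hx with ⟨h₁, h₂⟩ | ⟨h₁, h₂⟩
  · exact add_of_nonneg h₁ h₂ h h'
  · have := (add_of_nonneg (neg_nonneg.2 h₁) (neg_nonneg.2 h₂) h.neg h'.neg).neg
    rwa [← neg_add, ← neg_add, neg_neg, neg_neg] at this

/-- The factor `2` and the bound `1/2` come from `1 + u ≤ exp (2u)` and `exp (-2u) ≤ 1/(1 + 2u) ≤ 1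
- u`, the last of which is `u ≤ 1/2`. -/
theorem of_abs_sub_le {u : ℝ} (hu : 0 ≤ u) (hu' : u ≤ 1 / 2) (h : |y - x| ≤ u * |x|) :
    Near (2 * u) x y := by
  suffices key : ∀ x y : ℝ, 0 ≤ x → |y - x| ≤ u * |x| → Near (2 * u) x y by
    rcases le_total 0 x with hx | hx
    · exact key x y hx h
    · have := (key (-x) (-y) (neg_nonneg.2 hx) (by rwa [abs_neg, ← neg_sub_neg, neg_neg, neg_neg,
        abs_sub_comm])).neg
      rwa [neg_neg, neg_neg] at this
  intro x y hx h
  rw [abs_of_nonneg hx] at h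
  obtain ⟨h₁, h₂⟩ := abs_le.1 h
  rcases hx.eq_or_lt with rfl | hp
  · exact ⟨0, by simpa, by linarith⟩
  · refine of_bounds hp ?_ ?_
    · have e : Real.exp (-(2 * u)) ≤ 1 - u := by
        rw [Real.exp_neg, inv_le_comm₀ (Real.exp_pos _) (by linarith)]
        refine le_trans ?_ (Real.add_one_le_exp (2 * u))
        rw [inv_le_iff_one_le_mul₀ (by linarith)]
        nlinarith
      nlinarith
    · have e : 1 + u ≤ Real.exp (2 * u) := by linarith [Real.add_one_le_exp (2 * u)]
      nlinarith

theorem abs_sub_le (h : Near ε x y) (hε : ε ≤ 1) : |x - y| ≤ 2 * ε * |x| := by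
  obtain ⟨θ, hθ, rfl⟩ := h
  have := Real.abs_exp_sub_one_le (hθ.trans hε)
  rw [show x - x * Real.exp θ = -((Real.exp θ - 1) * x) by ring, abs_neg, abs_mul]
  gcongr
  linarith

end Near

/-! ### Forward error analysis of cancellation-free expressions. -/

namespace Ex

variable {V : Type} {u : ℝ}

/-- The exact value of an expression. -/
noncomputable def eval (u : ℝ) (x : V → ℝ) : Ex V → ℝ
  | zero => 0
  | one => 1
  | unit => u
  | var v => x v
  | add a b => a.eval u x + b.eval u x
  | mul a b => a.eval u x * b.eval u x
  | div a b => a.eval u x / b.eval u x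
  | neg a => -a.eval u x
  | sqrt a => √(a.eval u x)

/-- Only numbers of the same sign are added, and the exact evaluation meets no division by zero
and no root of a negative number. -/
def Good (u : ℝ) (x : V → ℝ) : Ex V → Prop
  | zero => True
  | one => True
  | unit => True
  | var _ => True
  | add a b => a.Good u x ∧ b.Good u x ∧ 0 ≤ a.eval u x * b.eval u x
  | mul a b => a.Good u x ∧ b.Good u x
  | div a b => a.Good u x ∧ b.Good u x ∧ b.eval u x ≠ 0
  | neg a => a.Good u x
  | sqrt a => a.Good u x ∧ 0 ≤ a.eval u x

/-- A bound for the error of the floating point evaluation in terms of the error `δ` of one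
operation and the errors `w` of the variables. -/
noncomputable def err (δ : ℝ) (w : V → ℝ) : Ex V → ℝ
  | zero => 0
  | one => 0
  | unit => 0
  | var v => w v
  | add a b => max (a.err δ w) (b.err δ w) + δ
  | mul a b => a.err δ w + b.err δ w + δ
  | div a b => a.err δ w + b.err δ w + δ
  | neg a => a.err δ w + δ
  | sqrt a => a.err δ w / 2 + δ

/-- Each operation composes the errors of its operands with one rounding of size `2u`. Logarithmic
nearness preserves signs and nonvanishing, so conditions on the exact evaluation already ensure that
the floating point one is defined. -/
theorem near_fl (F : FloatArith u) (hu : 0 ≤ u) (hu' : u ≤ 1 / 2) {x x' w : V → ℝ}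
    (hx : ∀ v, Near (w v) (x v) (x' v)) (e : Ex V) (he : e.Good u x) :
    e.Defined F x' ∧ Near (e.err (2 * u) w) (e.eval u x) (e.fl F x') := by
  induction e with
  | zero => exact ⟨trivial, .refl _⟩
  | one => exact ⟨trivial, .refl _⟩
  | unit => exact ⟨trivial, .refl _⟩
  | var v => exact ⟨trivial, hx v⟩
  | add a b iha ihb =>
    obtain ⟨da, na⟩ := iha he.1
    obtain ⟨db, nb⟩ := ihb he.2.1
    exact ⟨⟨da, db⟩, (Near.add he.2.2 (na.mono (le_max_left _ _)) (nb.mono (le_max_right _ _))).trans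
      (.of_abs_sub_le hu hu' (F.add_err _ _))⟩
  | mul a b iha ihb =>
    obtain ⟨da, na⟩ := iha he.1
    obtain ⟨db, nb⟩ := ihb he.2
    exact ⟨⟨da, db⟩, (na.mul nb).trans (.of_abs_sub_le hu hu' (F.mul_err _ _))⟩
  | div a b iha ihb =>
    obtain ⟨da, na⟩ := iha he.1
    obtain ⟨db, nb⟩ := ihb he.2.1
    have hb := nb.ne_zero he.2.2
    exact ⟨⟨da, db, hb⟩, (na.div nb).trans (.of_abs_sub_le hu hu' (F.div_err _ _ hb))⟩
  | neg a iha =>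
    obtain ⟨da, na⟩ := iha he
    refine ⟨da, na.neg.trans (.of_abs_sub_le hu hu' ?_)⟩
    have := F.sub_err 0 (a.fl F x')
    rwa [zero_sub] at this
  | sqrt a iha =>
    obtain ⟨da, na⟩ := iha he.1
    have h := na.nonneg he.2
    exact ⟨⟨da, h⟩, na.sqrt.trans (.of_abs_sub_le hu hu' (F.sqrt_err _ h))⟩

/-- The bound is homogeneous of degree one. With data errors proportional to `u` it is therefore `u`
times a number depending only on the expression, which is how the constants become independent of
`u` and of the data. -/
theorem err_smul {t : ℝ} (ht : 0 ≤ t) (δ : ℝ) (w : V → ℝ) (e : Ex V) :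
    e.err (t * δ) (fun v => t * w v) = t * e.err δ w := by
  induction e with
  | zero | one | unit => simp [err]
  | var v => rfl
  | add a b iha ihb => simp only [err, iha, ihb, ← mul_max_of_nonneg _ _ ht]; ring
  | mul a b iha ihb | div a b iha ihb => simp only [err, iha, ihb]; ring
  | neg a iha | sqrt a iha => simp only [err, iha]; ring

/-- On nonnegative data, the expression is evaluated without cancellation. -/
def Nonneg (u : ℝ) (x : V → ℝ) (e : Ex V) : Prop := e.Good u x ∧ 0 ≤ e.eval u x

namespace Nonneg

variable {x : V → ℝ} {a b : Ex V}

theorem add (ha : a.Nonneg u x) (hb : b.Nonneg u x) : (Ex.add a b).Nonneg u x :=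
  ⟨⟨ha.1, hb.1, mul_nonneg ha.2 hb.2⟩, add_nonneg ha.2 hb.2⟩

theorem mul (ha : a.Nonneg u x) (hb : b.Nonneg u x) : (Ex.mul a b).Nonneg u x :=
  ⟨⟨ha.1, hb.1⟩, mul_nonneg ha.2 hb.2⟩

theorem div (ha : a.Nonneg u x) (hb : b.Nonneg u x) (h : b.eval u x ≠ 0) :
    (Ex.div a b).Nonneg u x :=
  ⟨⟨ha.1, hb.1, h⟩, div_nonneg ha.2 hb.2⟩

theorem zero : (Ex.zero : Ex V).Nonneg u x := ⟨trivial, le_rfl⟩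

theorem one : (Ex.one : Ex V).Nonneg u x := ⟨trivial, zero_le_one⟩

end Nonneg

/-- The sum of a list of expressions. -/
def sum : List (Ex V) → Ex V
  | [] => zero
  | e :: l => add e (sum l)

/-- The sum of a family of expressions over a finite type. -/
noncomputable def fsum {T : Type} [Fintype T] (e : T → Ex V) : Ex V :=
  sum (Finset.univ.toList.map e)

theorem eval_fsum {T : Type} [Fintype T] (x : V → ℝ) (e : T → Ex V) :
    (fsum e).eval u x = ∑ t, (e t).eval u x := by
  rw [fsum, ← Finset.sum_map_toList]
  generalize (Finset.univ : Finset T).toList = l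
  induction l with
  | nil => rfl
  | cons t l ih => simp only [List.map_cons, sum, eval, List.sum_cons, ih]

/-- The number `σ` carries the common sign of all terms; it is `1` or `-1` in the applications. -/
theorem good_fsum {T : Type} [Fintype T] {x : V → ℝ} {e : T → Ex V} (he : ∀ t, (e t).Good u x)
    {σ : ℝ} (hσ : σ ≠ 0) (h : ∀ t, 0 ≤ σ * (e t).eval u x) : (fsum e).Good u x := by
  rw [fsum]
  generalize (Finset.univ : Finset T).toList = l
  suffices (sum (l.map e)).Good u x ∧ 0 ≤ σ * (sum (l.map e)).eval u x from this.1
  induction l with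
  | nil => exact ⟨trivial, by simp [sum, eval]⟩
  | cons t l ih =>
    refine ⟨⟨he t, ih.1, ?_⟩, ?_⟩
    · have := mul_nonneg (h t) ih.2
      have hs : 0 < σ ^ 2 := by positivity
      refine (mul_nonneg_iff_of_pos_left hs).1 ?_
      linarith
    · simp only [List.map_cons, sum, eval, mul_add]
      exact add_nonneg (h t) ih.2

theorem Nonneg.fsum {T : Type} [Fintype T] {x : V → ℝ} {e : T → Ex V}
    (he : ∀ t, (e t).Nonneg u x) : (fsum e).Nonneg u x :=
  ⟨good_fsum (fun t => (he t).1) one_ne_zero fun t => by simpa using (he t).2, by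
    rw [eval_fsum]; exact Finset.sum_nonneg fun t _ => (he t).2⟩

theorem err_fsum_le {T : Type} [Fintype T] {δ ε : ℝ} {w : V → ℝ} {e : T → Ex V} (hδ : 0 ≤ δ)
    (hε : 0 ≤ ε) (he : ∀ t, (e t).err δ w ≤ ε) :
    (Ex.fsum e).err δ w ≤ ε + Fintype.card T * δ := by
  rw [Ex.fsum, ← Finset.card_univ, ← Finset.length_toList]
  generalize (Finset.univ : Finset T).toList = l
  induction l with
  | nil => simpa [sum, err] using hε
  | cons t l ih =>
    simp only [List.map_cons, sum, err, List.length_cons]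
    push_cast
    have : 0 ≤ (l.length : ℝ) * δ := by positivity
    have := max_le ((he t).trans (le_add_of_nonneg_right this)) ih
    linarith

/-- A natural number as an expression. -/
def nat : ℕ → Ex V
  | 0 => zero
  | k + 1 => add (nat k) one

/-- A power of an expression. -/
def pow (e : Ex V) : ℕ → Ex V
  | 0 => one
  | k + 1 => mul (pow e k) e

theorem eval_nat (x : V → ℝ) (k : ℕ) : (nat k).eval u x = k := by
  induction k with
  | zero => simp [nat, eval]
  | succ k ih => simp [nat, eval, ih]

theorem eval_pow (x : V → ℝ) (e : Ex V) (k : ℕ) : (pow e k).eval u x = e.eval u x ^ k := by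
  induction k with
  | zero => simp [pow, eval]
  | succ k ih => simp [pow, eval, ih, pow_succ]

theorem Nonneg.nat {x : V → ℝ} (k : ℕ) : (nat k).Nonneg u x := by
  induction k with
  | zero => exact .zero
  | succ k ih => exact ih.add .one

theorem Nonneg.pow {x : V → ℝ} {e : Ex V} (h : e.Nonneg u x) (k : ℕ) :
    (pow e k).Nonneg u x := by
  induction k with
  | zero => exact .one
  | succ k ih => exact ih.mul h

theorem SubtractionFree.pow {e : Ex V} (h : e.SubtractionFree) (k : ℕ) :
    (pow e k).SubtractionFree := by
  induction k with
  | zero => trivial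
  | succ k ih => exact ⟨ih, h⟩

/-- A straight-line program is accurate to high relative accuracy on data given to high relative
accuracy, if no cancellation occurs. -/
theorem exists_near_straightLine {ι κ : Type} [Fintype κ] (e : κ → Ex ι) (c : ℝ) :
    ∃ E : ℝ, ∀ u, 0 ≤ u → u ≤ 1 / 2 → ∀ F : FloatArith u, ∀ x x' : ι → ℝ,
      (∀ i, Near (u * c) (x i) (x' i)) → (∀ k, (e k).Good u x) →
      ∃ y, (straightLine e).Computes F x' y ∧ ∀ k, Near (u * E) ((e k).eval u x) (y k) := by
  obtain ⟨E, hE⟩ : ∃ E : ℝ, ∀ k, (e k).err 2 (fun _ => c) ≤ E :=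
    ⟨∑ k, |(e k).err 2 (fun _ => c)|, fun k => (le_abs_self _).trans
      (Finset.single_le_sum (f := fun k => |(e k).err 2 (fun _ => c)|)
        (fun _ _ => abs_nonneg _) (Finset.mem_univ k))⟩
  refine ⟨E, fun u hu hu' F x x' hx he => ?_⟩
  have h := fun k => near_fl F hu hu' hx (e k) (he k)
  refine ⟨_, computes_straightLine F e x' fun k => (h k).1, fun k => (h k).2.mono ?_⟩
  rw [mul_comm 2 u, err_smul hu]
  exact mul_le_mul_of_nonneg_left (hE k) hu

end Ex

end LatticePath
namespace LatticePath

open Matrix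

/-! ### Compound matrices -/

section Compound

variable {N k : ℕ}

/-- The matrix of all minors of order `k`. -/
noncomputable def compound (k : ℕ) (A : Matrix (Fin N) (Fin N) ℝ) :
    Matrix (Fin k ↪o Fin N) (Fin k ↪o Fin N) ℝ :=
  of fun r c => (A.submatrix r c).det

theorem compound_apply (A : Matrix (Fin N) (Fin N) ℝ) (r c : Fin k ↪o Fin N) :
    compound k A r c = (A.submatrix r c).det := rfl

theorem orderEmb_eq_of_range_eq {r c : Fin k ↪o Fin N} (h : Set.range r = Set.range c) : r = c :=
  DFunLike.coe_injective ((r.strictMono.range_inj c.strictMono).1 h)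

/-- An injective `f` is uniquely the increasing enumeration of its image composed with a
permutation. -/
theorem sum_eq_sum_orderEmb_perm (g : (Fin k → Fin N) → ℝ)
    (hg : ∀ f, ¬ Function.Injective f → g f = 0) :
    ∑ f, g f = ∑ K : Fin k ↪o Fin N, ∑ σ : Equiv.Perm (Fin k), g (K ∘ σ) := by
  rw [← Fintype.sum_prod_type' (f := fun (K : Fin k ↪o Fin N) (σ : Equiv.Perm (Fin k)) =>
    g (K ∘ σ))]
  symm
  refine Finset.sum_of_injOn (fun p : (Fin k ↪o Fin N) × Equiv.Perm (Fin k) => p.1 ∘ p.2) ?_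
    (fun _ _ => Finset.mem_coe.2 (Finset.mem_univ _)) (fun f _ hf => hg f fun hinj => hf ?_)
    (fun _ _ => rfl)
  · rintro ⟨K, σ⟩ - ⟨K', σ'⟩ - h
    simp only at h
    obtain rfl : K = K' := orderEmb_eq_of_range_eq <| by
      rw [← σ.surjective.range_comp K, ← σ'.surjective.range_comp K', h]
    congr 1
    ext i
    exact congrArg _ (K.injective (congrFun h i))
  · have hcard : (Finset.univ.image f).card = k := by
      rw [Finset.card_image_of_injective _ hinj, Finset.card_univ, Fintype.card_fin]
    have hK := Finset.range_orderEmbOfFin (Finset.univ.image f) hcard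
    have : ∀ i, ∃ j, (Finset.univ.image f).orderEmbOfFin hcard j = f i := fun i => by
      rw [← Set.mem_range, hK]
      simp
    choose σ hσ using this
    have hσi : Function.Injective σ := fun i j h => hinj (by rw [← hσ, ← hσ, h])
    refine ⟨⟨(Finset.univ.image f).orderEmbOfFin hcard,
      Equiv.ofBijective σ (Finite.injective_iff_bijective.1 hσi)⟩,
      Finset.mem_coe.2 (Finset.mem_univ _), ?_⟩
    ext i
    simp [hσ]

/-- The Cauchy–Binet formula. -/
theorem compound_mul (A B : Matrix (Fin N) (Fin N) ℝ) :
    compound k (A * B) = compound k A * compound k B := by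
  ext r c
  -- Each row of the product is a combination of rows of `B`; expand by multilinearity. Choices of
  -- rows with a repetition will drop out, and the others are grouped by their image.
  have h₁ : ((A * B).submatrix r c).det =
      ∑ f : Fin k → Fin N, (∏ i, A (r i) (f i)) * (B.submatrix f c).det := by
    have e : (A * B).submatrix r c = fun i => ∑ j, A (r i) j • fun l => B j (c l) := by
      ext i l
      simp [mul_apply]
    rw [e]
    change detRowAlternating.toMultilinearMap _ = _
    rw [MultilinearMap.map_sum]
    refine Finset.sum_congr rfl fun f _ => ?_
    rw [MultilinearMap.map_smul_univ]
    rfl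
  rw [compound_apply, h₁, sum_eq_sum_orderEmb_perm]
  · rw [mul_apply]
    refine Finset.sum_congr rfl fun K _ => ?_
    rw [compound_apply, compound_apply, ← det_transpose (A.submatrix r K), det_apply',
      Finset.sum_mul]
    refine Finset.sum_congr rfl fun σ _ => ?_
    have := det_permute σ (B.submatrix K c)
    rw [submatrix_submatrix, Function.comp_id] at this
    rw [this]
    simp only [transpose_apply, submatrix_apply, Function.comp_apply]
    ring
  · intro f hf
    obtain ⟨i, j, hij, hne⟩ : ∃ i j, f i = f j ∧ i ≠ j := by
      simpa [Function.Injective] using hf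
    rw [det_zero_of_row_eq hne (by ext l; simp [hij]), mul_zero]

theorem compound_diagonal (d : Fin N → ℝ) :
    compound k (diagonal d) = diagonal fun r : Fin k ↪o Fin N => ∏ i, d (r i) := by
  ext r c
  rw [compound_apply]
  by_cases h : r = c
  · subst h
    rw [submatrix_diagonal _ _ r.injective, det_diagonal, diagonal_apply_eq]
    rfl
  · rw [diagonal_apply_ne _ h]
    by_contra hne
    have hr : ∀ i, ∃ j, c j = r i := by
      by_contra! hi
      obtain ⟨i, hi⟩ := hi
      exact hne (det_eq_zero_of_row_eq_zero i fun j => by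
        simp [diagonal_apply_ne _ (hi j).symm])
    choose σ hσ using hr
    have hσi : Function.Injective σ := fun i j h => r.injective (by rw [← hσ, ← hσ, h])
    refine h (orderEmb_eq_of_range_eq ?_)
    rw [show (r : Fin k → Fin N) = c ∘ σ from funext fun i => (hσ i).symm,
      (Finite.injective_iff_surjective.1 hσi).range_comp]

theorem compound_one : compound k (1 : Matrix (Fin N) (Fin N) ℝ) = 1 := by
  rw [← diagonal_one, compound_diagonal, ← diagonal_one]
  simp

theorem compound_transpose (A : Matrix (Fin N) (Fin N) ℝ) :
    compound k Aᵀ = (compound k A)ᵀ := by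
  ext r c
  rw [compound_apply, transpose_apply, compound_apply, ← det_transpose]
  rfl

theorem mul_nonneg_apply {l m n : Type*} [Fintype m] {A : Matrix l m ℝ} {B : Matrix m n ℝ}
    (hA : ∀ i j, 0 ≤ A i j) (hB : ∀ i j, 0 ≤ B i j) (i j) : 0 ≤ (A * B) i j := by
  rw [mul_apply]
  exact Finset.sum_nonneg fun k _ => mul_nonneg (hA i k) (hB k j)

/-- Nonnegative lower bidiagonal matrices are totally nonnegative. -/
theorem det_submatrix_nonneg_of_bidiagonal (A : Matrix (Fin N) (Fin N) ℝ)
    (h0 : ∀ i j, 0 ≤ A i j) (hA : ∀ i j : Fin N, i ≠ j → (i : ℕ) ≠ j + 1 → A i j = 0)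
    (r c : Fin k → Fin N) (hr : StrictMono r) (hc : StrictMono c) :
    0 ≤ (A.submatrix r c).det := by
  induction k with
  | zero => simp
  | succ k ih =>
    have hminor := ih (r ∘ Fin.succ) (c ∘ Fin.succ) (hr.comp (Fin.strictMono_succ))
      (hc.comp (Fin.strictMono_succ))
    have hr0 : ∀ i : Fin k, (r 0 : ℕ) < r i.succ := fun i => hr (Fin.succ_pos i)
    have hc0 : ∀ i : Fin k, (c 0 : ℕ) < c i.succ := fun i => hc (Fin.succ_pos i)
    -- If `r 0 ≤ c 0`, the later columns lie strictly above the diagonal in row `r 0`, so the first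
    -- row has only its first entry. Otherwise the later rows are at least `c 0 + 2`, and the first
    -- column has only its first entry.
    rcases le_or_gt (r 0 : ℕ) (c 0) with h | h
    · rw [det_succ_row_zero, Finset.sum_eq_single 0]
      · simpa using mul_nonneg (h0 _ _) hminor
      · intro j _ hj
        obtain ⟨j, rfl⟩ := Fin.exists_succ_eq.2 hj
        have := hc0 j
        rw [submatrix_apply, hA _ _ (fun e => by rw [Fin.ext_iff] at e; omega) (by omega)]
        simp
      · simp
    · rw [det_succ_column_zero, Finset.sum_eq_single 0]
      · simpa using mul_nonneg (h0 _ _) hminor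
      · intro j _ hj
        obtain ⟨j, rfl⟩ := Fin.exists_succ_eq.2 hj
        have := hr0 j
        rw [submatrix_apply, hA _ _ (fun e => by rw [Fin.ext_iff] at e; omega) (by omega)]
        simp
      · simp

end Compound

/-! ### The factors of the lattice path matrix -/

section Pascal

/-- The entries `C(i,k) x^(i-k)` of the scaled Pascal matrix. -/
noncomputable def pascalEntry (x : ℝ) (i k : ℕ) : ℝ := i.choose k * x ^ (i - k)

theorem pascalEntry_succ_succ (x : ℝ) (i k : ℕ) :
    pascalEntry x (i + 1) (k + 1) = x * pascalEntry x i (k + 1) + pascalEntry x i k := by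
  simp only [pascalEntry, Nat.choose_succ_succ, Nat.add_sub_add_right]
  push_cast
  rcases le_or_gt (k + 1) i with h | h
  · obtain ⟨m, rfl⟩ := Nat.exists_eq_add_of_le h
    rw [show k + 1 + m - k = m + 1 by omega, Nat.add_sub_cancel_left]
    ring
  · rw [Nat.choose_eq_zero_of_lt h]
    push_cast
    ring

theorem pascalEntry_succ_zero (x : ℝ) (i : ℕ) :
    pascalEntry x (i + 1) 0 = x * pascalEntry x i 0 := by
  simp [pascalEntry, pow_succ']

theorem pascalEntry_of_lt (x : ℝ) {i k : ℕ} (h : i < k) : pascalEntry x i k = 0 := by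
  simp [pascalEntry, Nat.choose_eq_zero_of_lt h]

theorem pascalEntry_eq_div {x : ℝ} (hx : x ≠ 0) (i k : ℕ) :
    pascalEntry x i k = x ^ i * i.choose k / x ^ k := by
  rcases le_or_gt k i with h | h
  · rw [pascalEntry, pow_sub₀ x hx h]
    field_simp
  · simp [pascalEntry, Nat.choose_eq_zero_of_lt h]

/-- Termwise this is `(l' - βl)(m' - αm) = (shift of l)(shift of m)`, expanded; shifting the index
back produces the factor `q` and shortens the last sum by one term. -/
theorem sum_mul_mul_of_recurrence {α β q : ℝ} {l m l' m' : ℕ → ℝ} (hl : l' 0 = β * l 0)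
    (hl' : ∀ k, l' (k + 1) = β * l (k + 1) + l k) (hm : m' 0 = α * m 0)
    (hm' : ∀ k, m' (k + 1) = α * m (k + 1) + m k) (M : ℕ) :
    ∑ k ∈ Finset.range (M + 1), l' k * q ^ k * m' k =
      α * ∑ k ∈ Finset.range (M + 1), l' k * q ^ k * m k +
      β * ∑ k ∈ Finset.range (M + 1), l k * q ^ k * m' k -
      α * β * ∑ k ∈ Finset.range (M + 1), l k * q ^ k * m k +
      q * ∑ k ∈ Finset.range M, l k * q ^ k * m k := by
  induction M with
  | zero => simp [hl, hm]; ring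
  | succ M ih =>
    rw [Finset.sum_range_succ, ih]
    rw [Finset.sum_range_succ (fun k => l' k * q ^ k * m k) (M + 1),
      Finset.sum_range_succ (fun k => l k * q ^ k * m' k) (M + 1),
      Finset.sum_range_succ (fun k => l k * q ^ k * m k) (M + 1),
      Finset.sum_range_succ (fun k => l k * q ^ k * m k) M, hl', hm']
    ring

theorem entry_eq_sum (α β γ : ℝ) (M i j : ℕ) (hi : i < M) (hj : j < M) :
    entry α β γ i j =
      ∑ k ∈ Finset.range M, pascalEntry β i k * (α * β + γ) ^ k * pascalEntry α j k := by
  induction i generalizing j M with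
  | zero =>
    rw [Finset.sum_eq_single_of_mem 0 (by simpa using hi) fun k _ hk => by
      rw [pascalEntry_of_lt β (Nat.pos_of_ne_zero hk)]; ring]
    simp [entry, pascalEntry]
  | succ i ih =>
    induction j with
    | zero =>
      rw [Finset.sum_eq_single_of_mem 0 (by simp; omega) fun k _ hk => by
        rw [pascalEntry_of_lt α (Nat.pos_of_ne_zero hk)]; ring]
      simp [entry, pascalEntry]
    | succ j ihj =>
      obtain ⟨M, rfl⟩ : ∃ m, M = m + 1 := ⟨M - 1, by omega⟩
      -- The term with `γ` is expanded over `range M` to match the shortened sum; the extra term `k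
      -- = M` of the sum with factor `αβ` vanishes because `i < M`.
      rw [entry, ihj (by omega), ih (M + 1) (j + 1) (by omega) hj,
        ih M j (by omega) (by omega), sum_mul_mul_of_recurrence (pascalEntry_succ_zero β i)
          (pascalEntry_succ_succ β i) (pascalEntry_succ_zero α j) (pascalEntry_succ_succ α j),
        Finset.sum_range_succ (fun k => pascalEntry β i k * (α * β + γ) ^ k * pascalEntry α j k) M,
        pascalEntry_of_lt β (show i < M by omega)]
      ring

/-! ### The bidiagonal decomposition -/

theorem upperProd_eq_transpose {N : ℕ} (B : Matrix (Fin N) (Fin N) ℝ) (k : ℕ) :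
    upperProd B k = (lowerProd Bᵀ k)ᵀ := by
  induction k with
  | zero => simp [upperProd, lowerProd]
  | succ k ih => rw [upperProd, lowerProd, transpose_mul, ih, upperFactor]

theorem latticeBD_transpose (n : ℕ) (α β γ : ℝ) :
    (latticeBD n α β γ)ᵀ = latticeBD n β α γ := by
  ext i j
  simp only [latticeBD, transpose_apply, of_apply]
  rcases lt_trichotomy i j with h | rfl | h
  · simp [h.ne, h.ne', h, h.not_gt]
  · simp [mul_comm]
  · simp [h.ne, h.ne', h, h.not_gt]

theorem lowerFactor_latticeBD (n : ℕ) (α β γ : ℝ) {k : ℕ} (hk : 1 ≤ k) (i j : Fin (n + 1)) :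
    lowerFactor (latticeBD n α β γ) k i j =
      if i = j then 1 else if (i : ℕ) = j + 1 ∧ k ≤ (i : ℕ) then β else 0 := by
  simp only [lowerFactor, of_apply]
  split_ifs with h₁ h₂
  · rfl
  · have h : (⟨i - k, lt_of_le_of_lt (Nat.sub_le _ _) i.2⟩ : Fin (n + 1)) < i := by
      rw [Fin.lt_def]; simp only; omega
    simp [latticeBD, h, h.ne']
  · rfl

/-- Multiplying by the next factor adds `β` times row `i - 1` to row `i` when `i ≥ k + 1`, which is
Pascal's rule on the upper index; the rows `i ≤ k` are already final, hence the minimum. -/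
theorem lowerProd_latticeBD (n : ℕ) (α β γ : ℝ) (k : ℕ) (i j : Fin (n + 1)) :
    lowerProd (latticeBD n α β γ) k i j =
      if (j : ℕ) ≤ i then ((min (i : ℕ) k).choose (i - j) : ℝ) * β ^ ((i : ℕ) - j) else 0 := by
  induction k generalizing i j with
  | zero =>
    rw [lowerProd, one_apply]
    split_ifs with h₁ h₂ h₂
    · simp [h₁]
    · exact absurd (h₁ ▸ le_rfl) h₂
    · have : 0 < (i : ℕ) - j := by rw [Fin.ext_iff] at h₁; omega
      simp [Nat.choose_eq_zero_of_lt this]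
    · rfl
  | succ k ih =>
    rw [lowerProd, mul_apply]
    simp only [lowerFactor_latticeBD n α β γ (Nat.succ_pos k)]
    by_cases hik : k + 1 ≤ (i : ℕ)
    · have hi : (⟨i - 1, by omega⟩ : Fin (n + 1)) ≠ i := by
        rw [Ne, Fin.ext_iff]; simp only; omega
      rw [← Finset.sum_subset (Finset.subset_univ {i, ⟨i - 1, by omega⟩}),
        Finset.sum_pair hi.symm, if_pos rfl, if_neg hi.symm,
        if_pos ⟨by simp only; omega, hik⟩, ih, ih]
      · simp only
        rcases lt_trichotomy (j : ℕ) i with h | h | h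
        · rw [if_pos h.le, if_pos (by omega), if_pos h.le,
            min_eq_right (by omega), min_eq_right (by omega), min_eq_right (by omega)]
          obtain ⟨d, hd⟩ : ∃ d, (i : ℕ) = j + (d + 1) := ⟨i - j - 1, by omega⟩
          rw [hd, show (j : ℕ) + (d + 1) - 1 - j = d by omega, Nat.add_sub_cancel_left,
            Nat.choose_succ_succ]
          push_cast
          ring
        · rw [if_pos h.le, if_neg (by omega), if_pos h.le, h]
          simp
        · rw [if_neg (by omega), if_neg (by omega), if_neg (by omega)]
          simp
      · intro l _ hl
        simp only [Finset.mem_insert, Finset.mem_singleton, not_or, Fin.ext_iff] at hl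
        rw [if_neg (fun h => hl.1 (by rw [h])), if_neg (by omega), zero_mul]
    · rw [Finset.sum_eq_single i, if_pos rfl, one_mul, ih, min_eq_left (by omega),
        min_eq_left (by omega)]
      · intro l _ hl
        rw [if_neg hl.symm, if_neg (fun h => hik h.2), zero_mul]
      · simp

theorem lowerProd_latticeBD_last (n : ℕ) (α β γ : ℝ) (i j : Fin (n + 1)) :
    lowerProd (latticeBD n α β γ) n i j = pascalEntry β i j := by
  rw [lowerProd_latticeBD, min_eq_left (by omega)]
  split_ifs with h
  · rw [Nat.choose_symm h]; rfl
  · rw [pascalEntry_of_lt _ (by omega)]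

theorem isBidiagonalDecomposition_latticeBD (n : ℕ) {α β γ : ℝ} (hα : 0 < α) (hβ : 0 < β)
    (hq : 0 < α * β + γ) :
    IsBidiagonalDecomposition (Lp n α β γ) (latticeBD n α β γ) where
  factorization := by
    ext i j
    rw [Nat.add_sub_cancel, upperProd_eq_transpose, latticeBD_transpose, mul_apply]
    simp only [mul_diagonal, transpose_apply, lowerProd_latticeBD_last]
    rw [Lp, of_apply, entry_eq_sum α β γ (n + 1) i j i.2 j.2, ← Fin.sum_univ_eq_sum_range
      (fun k => pascalEntry β i k * (α * β + γ) ^ k * pascalEntry α j k)]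
    simp [latticeBD]
  pivot_pos i := by simpa [latticeBD] using pow_pos hq _
  multiplier_nonneg i j h := by
    simp only [latticeBD, of_apply, if_neg h]
    split_ifs <;> positivity
  lower_zero i j h hj _ h0 := by
    simp only [latticeBD, of_apply, if_neg hj.ne', if_pos hj] at h0
    exact absurd h0 hβ.ne'
  upper_zero i j h hj _ h0 := by
    simp only [latticeBD, of_apply, if_neg hj.ne, if_neg hj.not_gt] at h0
    exact absurd h0 hα.ne'

/-! ### Minors of the lattice path matrix -/

/-- The Pascal matrix. -/
noncomputable def pascal (N : ℕ) : Matrix (Fin N) (Fin N) ℝ :=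
  of fun i j => ((i : ℕ).choose j : ℝ)

/-- The minors of the Pascal matrix as natural numbers. -/
noncomputable def pascalMinor {N k : ℕ} (r c : Fin k ↪o Fin N) : ℕ :=
  (of fun i j : Fin k => ((r i : ℕ).choose (c j) : ℤ)).det.toNat

theorem compound_nonneg_of_mul {N k : ℕ} {A B : Matrix (Fin N) (Fin N) ℝ}
    (hA : ∀ r c, 0 ≤ compound k A r c) (hB : ∀ r c, 0 ≤ compound k B r c)
    (r c : Fin k ↪o Fin N) : 0 ≤ compound k (A * B) r c := by
  rw [compound_mul]
  exact mul_nonneg_apply hA hB r c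

/-- The Pascal matrix is the product of the nonnegative bidiagonal factors with all multipliers `1`,
and Cauchy–Binet carries nonnegative minors to products. -/
theorem compound_pascal_nonneg {N k : ℕ} (r c : Fin k ↪o Fin N) :
    0 ≤ compound k (pascal N) r c := by
  rcases N with _ | n
  · cases k with
    | zero => simp [compound_apply]
    | succ k => exact (r 0).elim0
  · have h : pascal (n + 1) = lowerProd (latticeBD n 1 1 0) n := by
      ext i j
      rw [lowerProd_latticeBD_last]
      simp [pascal, pascalEntry]
    rw [h]
    suffices ∀ p, ∀ r c : Fin k ↪o Fin (n + 1), 0 ≤ compound k (lowerProd (latticeBD n 1 1 0) p) r c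
      from this _ _ _
    intro p
    induction p with
    | zero =>
      intro r c
      rw [lowerProd, compound_one, one_apply]
      split_ifs <;> norm_num
    | succ p ih =>
      refine compound_nonneg_of_mul (fun r c => ?_) ih
      refine det_submatrix_nonneg_of_bidiagonal _ (fun i j => ?_) (fun i j h h' => ?_) r c
        r.strictMono c.strictMono
      · rw [lowerFactor_latticeBD n 1 1 0 (Nat.succ_pos p)]
        split_ifs <;> norm_num
      · rw [lowerFactor_latticeBD n 1 1 0 (Nat.succ_pos p), if_neg h, if_neg (fun e => h' e.1)]

/-- Nonnegativity makes the truncation in `toNat` harmless. Being natural, these minors can be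
formed by programs as sums of ones. -/
theorem cast_pascalMinor {N k : ℕ} (r c : Fin k ↪o Fin N) :
    (pascalMinor r c : ℝ) = compound k (pascal N) r c := by
  have h : (((of fun i j : Fin k => ((r i : ℕ).choose (c j) : ℤ)).det : ℤ) : ℝ) =
      compound k (pascal N) r c := by
    rw [compound_apply, ← eq_intCast (Int.castRingHom ℝ), RingHom.map_det]
    congr 1
  have h0 := compound_pascal_nonneg r c
  rw [← h] at h0 ⊢
  rw [pascalMinor, ← Int.cast_natCast, Int.toNat_of_nonneg (by exact_mod_cast h0)]

/-- The initial minors of the Pascal matrix do not vanish. -/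
theorem compound_pascal_initial_pos {N k : ℕ} (hk : k ≤ N) (r : Fin k ↪o Fin N) :
    0 < compound k (pascal N) r (Fin.castLEOrderEmb hk) := by
  refine lt_of_le_of_ne (compound_pascal_nonneg _ _) (Ne.symm fun h => ?_)
  -- Scaling column `j` of the minor by `j!` turns it into the values of a monic polynomial of
  -- degree `j` at the points `r i`, so its determinant is that of Vandermonde.
  have hv := det_eval_matrixOfPolynomials_eq_det_vandermonde (fun i => ((r i : ℕ) : ℝ))
    (fun j : Fin k => descPochhammer ℝ j) (fun j => descPochhammer_natDegree ℝ j)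
    (fun j => monic_descPochhammer ℝ j)
  have he : (of fun i j : Fin k => (descPochhammer ℝ j).eval ((r i : ℕ) : ℝ)) =
      of fun i j : Fin k => ((j : ℕ).factorial : ℝ) *
        (pascal N).submatrix r (Fin.castLEOrderEmb hk) i j := by
    ext i j
    rw [of_apply, descPochhammer_eval_eq_descFactorial, Nat.descFactorial_eq_factorial_mul_choose]
    simp [pascal]
  rw [he, det_mul_row, ← compound_apply, h, mul_zero] at hv
  refine det_vandermonde_ne_zero_iff.2 (fun i j hij => r.injective ?_) hv
  exact Fin.ext (by exact_mod_cast hij)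

/-- The sum of the positions selected by an embedding. -/
def weight {N k : ℕ} (r : Fin k ↪o Fin N) : ℕ := ∑ i, (r i : ℕ)

theorem compound_diagonal_pow {N k : ℕ} (x : ℝ) :
    compound k (diagonal fun i : Fin N => x ^ (i : ℕ)) = diagonal fun r => x ^ weight r := by
  rw [compound_diagonal]
  simp only [weight, Finset.prod_pow_eq_pow_sum]

/-- The lattice path matrix in terms of Pascal matrices and diagonal matrices. -/
theorem Lp_eq_mul (n : ℕ) {a b q : ℝ} (ha : a ≠ 0) (hb : b ≠ 0) :
    Lp n a b (q - a * b) = diagonal (fun i : Fin (n + 1) => b ^ (i : ℕ)) * (pascal (n + 1) *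
      diagonal (fun i : Fin (n + 1) => (q / (a * b)) ^ (i : ℕ)) * (pascal (n + 1))ᵀ) *
      diagonal fun i : Fin (n + 1) => a ^ (i : ℕ) := by
  ext i j
  rw [mul_diagonal, diagonal_mul, mul_apply, Lp, of_apply,
    entry_eq_sum a b _ (n + 1) i j i.2 j.2, ← Fin.sum_univ_eq_sum_range
      (fun k => pascalEntry b i k * (a * b + (q - a * b)) ^ k * pascalEntry a j k),
    Finset.mul_sum, Finset.sum_mul]
  refine Finset.sum_congr rfl fun k _ => ?_
  rw [mul_diagonal, pascalEntry_eq_div ha, pascalEntry_eq_div hb, add_sub_cancel, div_pow,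
    mul_pow]
  simp only [pascal, of_apply, transpose_apply]
  field_simp

/-- Here `q` is an independent variable: it is a stored pivot, whereas recovering `γ = q - ab` from
the decomposition would cancel. In terms of `a`, `b`, `q` nothing is subtracted. -/
theorem compound_Lp (n : ℕ) {k : ℕ} {a b q : ℝ} (ha : a ≠ 0) (hb : b ≠ 0)
    (r c : Fin k ↪o Fin (n + 1)) :
    compound k (Lp n a b (q - a * b)) r c =
      b ^ weight r * (∑ s, (pascalMinor r s * pascalMinor c s : ℕ) * (q / (a * b)) ^ weight s) *
        a ^ weight c := by
  rw [Lp_eq_mul n ha hb, compound_mul, compound_mul, compound_mul, compound_mul,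
    compound_diagonal_pow, compound_diagonal_pow, compound_diagonal_pow, compound_transpose,
    mul_diagonal, diagonal_mul, mul_apply]
  congr 2
  refine Finset.sum_congr rfl fun s _ => ?_
  rw [mul_diagonal, transpose_apply, ← cast_pascalMinor, ← cast_pascalMinor]
  push_cast
  ring

theorem compound_Lp_pos (n : ℕ) {k : ℕ} {a b q : ℝ} (ha : 0 < a) (hb : 0 < b) (hq : 0 < q)
    (r c : Fin k ↪o Fin (n + 1)) : 0 < compound k (Lp n a b (q - a * b)) r c := by
  rw [compound_Lp n ha.ne' hb.ne']
  have hk : k ≤ n + 1 := by simpa using Fintype.card_le_of_injective r r.injective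
  have h : 0 < ∑ s, (pascalMinor r s * pascalMinor c s : ℕ) * (q / (a * b)) ^ weight s := by
    refine Finset.sum_pos' (fun s _ => by positivity)
      ⟨Fin.castLEOrderEmb hk, Finset.mem_univ _, mul_pos ?_ (by positivity)⟩
    push_cast
    rw [cast_pascalMinor, cast_pascalMinor]
    exact mul_pos (compound_pascal_initial_pos hk r) (compound_pascal_initial_pos hk c)
  positivity

theorem isSTP_Lp (n : ℕ) {α β γ : ℝ} (hα : 0 < α) (hβ : 0 < β) (hq : 0 < α * β + γ) :
    IsSTP (Lp n α β γ) := fun k r c => by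
  simpa [compound_apply] using compound_Lp_pos n hα hβ hq r c

end Pascal

end LatticePath
namespace LatticePath

open Matrix

/-! ### Traces of powers of compound matrices -/

section Trace

variable {N : ℕ}

theorem conj_pow {m : Type*} [Fintype m] [DecidableEq m] {X D X' : Matrix m m ℝ}
    (h : X' * X = 1) (j : ℕ) : (X * D * X') ^ j = X * D ^ j * X' := by
  induction j with
  | zero => simp [mul_eq_one_comm.1 h]
  | succ j ih =>
    rw [pow_succ, ih, pow_succ]
    calc X * D ^ j * X' * (X * D * X') = X * D ^ j * (X' * X) * (D * X') := by
          simp only [Matrix.mul_assoc]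
      _ = _ := by rw [h]; simp only [Matrix.mul_assoc, Matrix.one_mul]

/-- Compounds are multiplicative, so the compound of a diagonalization diagonalizes the compound,
with the `k`-fold products of eigenvalues on the diagonal. -/
theorem trace_compound_pow {A Z Z' : Matrix (Fin N) (Fin N) ℝ} {d : Fin N → ℝ}
    (h : Z' * Z = 1) (hA : A = Z * diagonal d * Z') (k m : ℕ) :
    (compound k A ^ m).trace = ∑ r : Fin k ↪o Fin N, (∏ i, d (r i)) ^ m := by
  have h' : compound k Z' * compound k Z = 1 := by rw [← compound_mul, h, compound_one]
  rw [hA, compound_mul, compound_mul, compound_diagonal, conj_pow h', trace_mul_comm,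
    ← Matrix.mul_assoc, h', Matrix.one_mul, diagonal_pow, trace_diagonal]
  rfl

theorem le_orderEmb {k : ℕ} (r : Fin k ↪o Fin N) (i : Fin k) : (i : ℕ) ≤ r i := by
  obtain ⟨i, hi⟩ := i
  induction i with
  | zero => exact Nat.zero_le _
  | succ i ih =>
    have h₁ := ih (by omega)
    have h₂ : r ⟨i, by omega⟩ < r ⟨i + 1, hi⟩ := r.strictMono (by simp [Fin.lt_def])
    rw [Fin.lt_def] at h₂
    simp only at h₁ ⊢
    omega

/-- The largest `k`-fold product is that of the first `k` eigenvalues, since `i ≤ r i`; it is one of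
the summands and bounds each of them. -/
theorem trace_compound_pow_bounds {A Z Z' : Matrix (Fin N) (Fin N) ℝ} {d : Fin N → ℝ}
    (h : Z' * Z = 1) (hA : A = Z * diagonal d * Z') (hd : Antitone d) (hd0 : ∀ i, 0 < d i)
    {k : ℕ} (hk : k ≤ N) (m : ℕ) :
    (∏ i, d (Fin.castLE hk i)) ^ m ≤ (compound k A ^ m).trace ∧
      (compound k A ^ m).trace ≤
        Fintype.card (Fin k ↪o Fin N) * (∏ i, d (Fin.castLE hk i)) ^ m := by
  rw [trace_compound_pow h hA]
  have hpos : ∀ r : Fin k ↪o Fin N, 0 ≤ ∏ i, d (r i) := fun r =>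
    Finset.prod_nonneg fun i _ => (hd0 _).le
  constructor
  · exact Finset.single_le_sum (f := fun r : Fin k ↪o Fin N => (∏ i, d (r i)) ^ m)
      (fun r _ => pow_nonneg (hpos r) m) (Finset.mem_univ (Fin.castLEOrderEmb hk))
  · rw [← nsmul_eq_mul, ← Finset.card_univ]
    refine Finset.sum_le_card_nsmul _ _ _ fun r _ => pow_le_pow_left₀ (hpos r) ?_ m
    exact Finset.prod_le_prod (fun i _ => (hd0 _).le) fun i _ =>
      hd (Fin.le_def.2 (by simpa using le_orderEmb r i))

end Trace

/-! ### Singular values of real square matrices -/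

section SingularValues

variable {N : ℕ}

/-- The spectral theorem for `RᵀR`. It serves the singular values directly and, through a diagonal
similarity, the eigenvalues. -/
theorem exists_diagonalization_transpose_mul_self (R : Matrix (Fin N) (Fin N) ℝ) :
    ∃ Z : Matrix (Fin N) (Fin N) ℝ, Zᵀ * Z = 1 ∧
      Rᵀ * R = Z * diagonal (fun i : Fin N => (toEuclideanLin R).singularValues i ^ 2) * Zᵀ := by
  have hn : Module.finrank ℝ (EuclideanSpace ℝ (Fin N)) = N := by simp
  obtain ⟨b, hb⟩ : ∃ b : OrthonormalBasis (Fin N) ℝ (EuclideanSpace ℝ (Fin N)), ∀ j : Fin N,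
      LinearMap.adjoint (toEuclideanLin R) (toEuclideanLin R (b j)) =
        ((toEuclideanLin R).singularValues j ^ 2) • b j := by
    refine ⟨(toEuclideanLin R).isSymmetric_adjoint_comp_self.eigenvectorBasis hn, fun j => ?_⟩
    rw [(toEuclideanLin R).sq_singularValues_fin hn j]
    exact (toEuclideanLin R).isSymmetric_adjoint_comp_self.apply_eigenvectorBasis hn j
  let Z : Matrix (Fin N) (Fin N) ℝ := of fun i j => b j i
  have hZ : Zᵀ * Z = 1 := by
    ext i j
    have h := orthonormal_iff_ite.1 b.orthonormal j i
    rw [one_apply, mul_apply]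
    simp only [PiLp.inner_apply, eq_comm (a := j)] at h
    rw [← h]
    exact Finset.sum_congr rfl fun l _ => by simp [Z]
  have hcol : Rᵀ * R * Z =
      Z * diagonal fun i : Fin N => (toEuclideanLin R).singularValues i ^ 2 := by
    ext i j
    have h := congrFun (congrArg WithLp.ofLp (hb j)) i
    rw [← toEuclideanLin_conjTranspose_eq_adjoint, ofLp_toLpLin, ofLp_toLpLin, toLin'_apply,
      toLin'_apply, mulVec_mulVec, conjTranspose_eq_transpose_of_trivial] at h
    rw [mul_diagonal, mul_comm]
    exact h
  refine ⟨Z, hZ, ?_⟩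
  rw [← hcol, Matrix.mul_assoc, mul_eq_one_comm.1 hZ, Matrix.mul_one]

theorem singularValues_pos_of_det_ne_zero {R : Matrix (Fin N) (Fin N) ℝ} (hR : R.det ≠ 0)
    (i : Fin N) : 0 < (toEuclideanLin R).singularValues i := by
  obtain ⟨Z, -, h⟩ := exists_diagonalization_transpose_mul_self R
  refine lt_of_le_of_ne (LinearMap.singularValues_nonneg _ _) (Ne.symm fun h0 => hR ?_)
  have := congrArg det h
  rw [det_mul, det_mul, det_mul, det_diagonal, Finset.prod_eq_zero (Finset.mem_univ i) (by
    rw [h0]; norm_num), det_transpose] at this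
  simpa using this

end SingularValues

end LatticePath
namespace LatticePath

open Matrix

/-! ### Ratios of dominant eigenvalues by repeated squaring -/

section RootProgram

variable {ι : Type} {N : ℕ}

/-- The state of the program: a counter, its growth factor, the number `1`, a family of matrices,
and a number for each matrix. -/
abbrev RootVar (T : Fin N → Type) : Type := Fin 3 ⊕ (Σ k, T k × T k) ⊕ Fin N

variable {T : Fin N → Type}

/-- Initialisation. -/
def initEx (e : ∀ k, T k → T k → Ex (ι ⊕ RootVar T)) : RootVar T → Ex (ι ⊕ RootVar T)
  | .inl 0 => .unit
  | .inl 1 => .sqrt (.add .one .one)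
  | .inl 2 => .one
  | .inr (.inl m) => e m.1 m.2.1 m.2.2
  | .inr (.inr _) => .zero

/-- One squaring of all matrices. -/
noncomputable def squareEx [∀ k, Fintype (T k)] : RootVar T → Ex (ι ⊕ RootVar T)
  | .inl 0 => .mul (.var (.inr (.inl 0))) (.var (.inr (.inl 1)))
  | .inl 1 => .var (.inr (.inl 1))
  | .inl 2 => .var (.inr (.inl 2))
  | .inr (.inl m) => .fsum fun l => .mul (.var (.inr (.inr (.inl ⟨m.1, m.2.1, l⟩))))
      (.var (.inr (.inr (.inl ⟨m.1, l, m.2.2⟩))))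
  | .inr (.inr k) => .var (.inr (.inr (.inr k)))

/-- The traces of all matrices. -/
noncomputable def traceEx [∀ k, Fintype (T k)] : RootVar T → Ex (ι ⊕ RootVar T)
  | .inl 0 => .unit
  | .inl 1 => .var (.inr (.inl 1))
  | .inl 2 => .var (.inr (.inl 2))
  | .inr (.inl m) => .var (.inr (.inr (.inl m)))
  | .inr (.inr k) => .fsum fun i => .var (.inr (.inr (.inl ⟨k, i, i⟩)))

/-- One square root of all numbers. -/
def rootEx : RootVar T → Ex (ι ⊕ RootVar T)
  | .inl 0 => .mul (.var (.inr (.inl 0))) (.var (.inr (.inl 1)))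
  | .inl 1 => .var (.inr (.inl 1))
  | .inl 2 => .var (.inr (.inl 2))
  | .inr (.inl m) => .var (.inr (.inr (.inl m)))
  | .inr (.inr k) => .sqrt (.var (.inr (.inr (.inr k))))

/-- The quotients of successive numbers, or their square roots. -/
def quotientEx (s : Bool) (k : Fin N) : Ex (ι ⊕ RootVar T) :=
  let q : Ex (ι ⊕ RootVar T) := if h : (k : ℕ) = 0 then .var (.inr (.inr (.inr k))) else
    .div (.var (.inr (.inr (.inr k)))) (.var (.inr (.inr (.inr ⟨k - 1, by omega⟩))))
  if s then .sqrt q else q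

/-- The program that squares the matrices often enough and takes as many roots of the traces. -/
noncomputable def rootProgram [∀ k, Fintype (T k)] (e : ∀ k, T k → T k → Ex (ι ⊕ RootVar T)) (s : Bool) :
    Program ι (Fin N) :=
  .seq (update (initEx e)) <|
  .seq (.while (slot (.inl 0 : RootVar T)) (slot (.inl 2 : RootVar T)) (update (squareEx (T := T)))) <|
  .seq (update (traceEx (T := T))) <|
  .seq (.while (slot (.inl 0 : RootVar T)) (slot (.inl 2 : RootVar T)) (update (rootEx (T := T)))) <|
  Ex.assign place (quotientEx (T := T) s) .output (1 + Fintype.card (RootVar T))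

/-- The values of the counter. -/
noncomputable def counter {u : ℝ} (F : FloatArith u) : ℕ → ℝ
  | 0 => u
  | j + 1 => F.mul (counter F j) (F.sqrt (F.add 1 1))

/-- The growth factor is a computed `√2` because both bounds must survive rounding: growth by at
least `5/4` forces the loop to stop, and growth by at most `2` forces `2^p u ≥ 1` when it does. -/
theorem counter_bounds {u : ℝ} (F : FloatArith u) (hu : 0 < u) (hu' : u ≤ 1 / 100) (j : ℕ) :
    (5 / 4) ^ j * u ≤ counter F j ∧ counter F j ≤ 2 ^ j * u := by
  have h2 := abs_le.1 (F.add_err 1 1)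
  rw [show (1 : ℝ) + 1 = 2 by norm_num, abs_two] at h2
  have hs := F.sqrt_err (F.add 1 1) (by linarith)
  rw [abs_of_nonneg (Real.sqrt_nonneg _)] at hs
  have hs' := abs_le.1 hs
  have h₁ : 1.38 ≤ √(F.add 1 1) := Real.le_sqrt_of_sq_le (by norm_num; linarith)
  have h₂ : √(F.add 1 1) ≤ 1.44 := Real.sqrt_le_iff.2 ⟨by norm_num, by norm_num; linarith⟩
  have h₃ : 1.3 ≤ F.sqrt (F.add 1 1) := by nlinarith
  have h₄ : F.sqrt (F.add 1 1) ≤ 1.5 := by nlinarith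
  induction j with
  | zero => simp [counter]
  | succ j ih =>
    have hc : 0 < counter F j := (by positivity : 0 < (5 / 4) ^ j * u).trans_le ih.1
    have hm := F.mul_err (counter F j) (F.sqrt (F.add 1 1))
    rw [abs_of_nonneg (a := counter F j * F.sqrt (F.add 1 1)) (by positivity)] at hm
    have hm' := abs_le.1 hm
    have hp := mul_le_mul_of_nonneg_left h₃ hc.le
    have hp' := mul_le_mul_of_nonneg_left h₄ hc.le
    have hup : u * (counter F j * F.sqrt (F.add 1 1)) ≤
        1 / 100 * (counter F j * F.sqrt (F.add 1 1)) := by gcongr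
    have hlow : 5 / 4 * counter F j ≤ F.mul (counter F j) (F.sqrt (F.add 1 1)) := by linarith
    have hupp : F.mul (counter F j) (F.sqrt (F.add 1 1)) ≤ 2 * counter F j := by linarith
    rw [counter, pow_succ', pow_succ', mul_assoc, mul_assoc]
    exact ⟨le_trans (by linarith [ih.1]) hlow, hupp.trans (by linarith [ih.2])⟩

theorem exists_least_one_le_counter {u : ℝ} (F : FloatArith u) (hu : 0 < u) (hu' : u ≤ 1 / 100) :
    ∃ p, (∀ j < p, counter F j < 1) ∧ ¬ counter F p < 1 ∧ 1 / 2 ^ p ≤ u := by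
  classical
  have hex : ∃ p, ¬ counter F p < 1 := by
    obtain ⟨p, hp⟩ := pow_unbounded_of_one_lt (1 / u) (show (1 : ℝ) < 5 / 4 by norm_num)
    refine ⟨p, fun h => ?_⟩
    rw [div_lt_iff₀ hu] at hp
    linarith [(counter_bounds F hu hu' p).1]
  refine ⟨Nat.find hex, fun j hj => not_not.1 (Nat.find_min hex hj), Nat.find_spec hex, ?_⟩
  have h := Nat.find_spec hex
  have h' := (counter_bounds F hu hu' (Nat.find hex)).2
  rw [div_le_iff₀ (by positivity)]
  linarith

theorem pow_apply_nonneg {m : Type} [Fintype m] [DecidableEq m] {X : Matrix m m ℝ}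
    (hX : ∀ i j, 0 ≤ X i j) (p : ℕ) (i j : m) : 0 ≤ (X ^ p) i j := by
  induction p generalizing i j with
  | zero => rw [pow_zero, one_apply]; split_ifs <;> norm_num
  | succ p ih => rw [pow_succ]; exact mul_nonneg_apply ih hX i j

/-- The iterates of an update. -/
noncomputable def iterate {V : Type} {u : ℝ} (F : FloatArith u) (e : V → Ex (ι ⊕ V)) (x : ι → ℝ)
    (y : V → ℝ) : ℕ → V → ℝ
  | 0 => y
  | j + 1 => fun v => (e v).fl F (Sum.elim x (iterate F e x y j))

/-- Squaring doubles the error and adds at most `(2 + 2 card) u ≤ C u` of rounding. The subtracted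
`C` makes the invariant reproduce itself: `2(2^j E - C) + C = 2^(j+1) E - C`. -/
theorem squareEx_iterate [∀ k, Fintype (T k)] [∀ k, DecidableEq (T k)] {u : ℝ} (F : FloatArith u) (hu : 0 ≤ u)
    (hu' : u ≤ 1 / 2) (x : ι → ℝ) (y : RootVar T → ℝ) (h0 : y (.inl 0) = u)
    (h1 : y (.inl 1) = F.sqrt (F.add 1 1)) (h2 : y (.inl 2) = 1)
    (X : ∀ k, Matrix (T k) (T k) ℝ) (hX : ∀ k i j, 0 ≤ X k i j) {E C : ℝ}
    (hC : ∀ k, 2 + 2 * (Fintype.card (T k) : ℝ) ≤ C) (hE : C ≤ E)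
    (hy : ∀ k i j, Near (u * (E - C)) (X k i j) (y (.inr (.inl ⟨k, i, j⟩)))) (j : ℕ) :
    (∀ v, (squareEx v).Defined F (Sum.elim x (iterate F squareEx x y j))) ∧
    iterate F squareEx x y j (.inl 0) = counter F j ∧
    iterate F squareEx x y j (.inl 1) = F.sqrt (F.add 1 1) ∧
    iterate F squareEx x y j (.inl 2) = 1 ∧
    ∀ k i l, Near (u * (2 ^ j * E - C)) ((X k ^ 2 ^ j) i l)
      (iterate F squareEx x y j (.inr (.inl ⟨k, i, l⟩))) := by
  have key : ∀ (j : ℕ) (z : RootVar T → ℝ),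
      (∀ k i l, Near (u * (2 ^ j * E - C)) ((X k ^ 2 ^ j) i l) (z (.inr (.inl ⟨k, i, l⟩)))) →
      (∀ v, (squareEx v).Defined F (Sum.elim x z)) ∧
      ∀ k i l, Near (u * (2 ^ (j + 1) * E - C)) ((X k ^ 2 ^ (j + 1)) i l)
        ((squareEx (.inr (.inl ⟨k, i, l⟩))).fl F (Sum.elim x z)) := by
    intro j z hz
    -- Only the matrix entries are compared with exact values; all other registers are compared with
    -- themselves, at error `0`.
    let x' : ι ⊕ RootVar T → ℝ := Sum.elim x fun v => match v with
      | .inr (.inl m) => (X m.1 ^ 2 ^ j) m.2.1 m.2.2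
      | v => z v
    let w : ι ⊕ RootVar T → ℝ := Sum.elim 0 fun v => match v with
      | .inr (.inl _) => u * (2 ^ j * E - C)
      | _ => 0
    have hw : ∀ v, Near (w v) (x' v) (Sum.elim x z v) := by
      rintro (i | i | ⟨k, i, l⟩ | k)
      · exact .refl _
      · exact .refl _
      · exact hz k i l
      · exact .refl _
    have hgood : ∀ k i l, (squareEx (ι := ι) (.inr (.inl ⟨k, i, l⟩)) : Ex (ι ⊕ RootVar T)).Nonneg
        u x' := fun k i l => Ex.Nonneg.fsum fun s => Ex.Nonneg.mul
          ⟨trivial, pow_apply_nonneg (hX k) _ _ _⟩ ⟨trivial, pow_apply_nonneg (hX k) _ _ _⟩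
    have hnear := fun k i l => Ex.near_fl F hu hu' hw _ (hgood k i l).1
    refine ⟨?_, fun k i l => ?_⟩
    · rintro (i | ⟨k, i, l⟩ | k)
      · fin_cases i
        · exact ⟨trivial, trivial⟩
        · trivial
        · trivial
      · exact (hnear k i l).1
      · trivial
    · have h := (hnear k i l).2
      have e : (squareEx (ι := ι) (.inr (.inl ⟨k, i, l⟩)) : Ex (ι ⊕ RootVar T)).eval u x' =
          (X k ^ 2 ^ (j + 1)) i l := by
        rw [pow_succ 2 j, pow_mul, sq, mul_apply]
        exact Ex.eval_fsum _ _
      rw [e] at h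
      refine h.mono ?_
      have hpow : 1 * E ≤ 2 ^ j * E := by
        have : 0 ≤ E := by
          have := hC k
          have : (0 : ℝ) ≤ Fintype.card (T k) := by positivity
          linarith
        gcongr
        exact one_le_pow₀ (by norm_num)
      refine (Ex.err_fsum_le (ε := u * (2 ^ j * E - C) + u * (2 ^ j * E - C) + 2 * u)
        (by linarith) ?_ fun s => le_rfl).trans ?_
      · have := mul_nonneg hu (show 0 ≤ 2 ^ j * E - C by linarith)
        linarith
      · have := mul_le_mul_of_nonneg_left (hC k) hu
        rw [pow_succ]
        linarith
  induction j with
  | zero =>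
    have hz : ∀ k i l, Near (u * (2 ^ 0 * E - C)) ((X k ^ 2 ^ 0) i l)
        (y (.inr (.inl ⟨k, i, l⟩))) := by simpa using hy
    exact ⟨(key 0 y hz).1, h0, h1, h2, hz⟩
  | succ j ih =>
    obtain ⟨-, i0, i1, i2, ih⟩ := ih
    have hz := (key j _ ih).2
    refine ⟨(key (j + 1) _ hz).1, ?_, i1, i2, hz⟩
    change F.mul (iterate F squareEx x y j (.inl 0)) (iterate F squareEx x y j (.inl 1)) = _
    rw [i0, i1]
    rfl

/-- A root halves the error and adds `2u`. The term `4u` is the fixed point of `ε ↦ ε/2 + 2u`, while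
`A` is the accuracy aimed at and `L` the logarithm of the factor lost by replacing a dominant
eigenvalue by a trace. -/
theorem rootEx_iterate {u : ℝ} (F : FloatArith u) (hu : 0 ≤ u) (hu' : u ≤ 1 / 2) (x : ι → ℝ)
    (y : RootVar T → ℝ) (h0 : y (.inl 0) = u) (h1 : y (.inl 1) = F.sqrt (F.add 1 1))
    (h2 : y (.inl 2) = 1) (a : Fin N → ℝ) (ha : ∀ k, 0 ≤ a k) {A L : ℝ} (p : ℕ)
    (hy : ∀ k, Near (2 ^ p * A + L + 4 * u) (a k ^ 2 ^ p) (y (.inr (.inr k)))) (j q : ℕ)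
    (hj : j + q = p) :
    (∀ v, (rootEx v).Defined F (Sum.elim x (iterate F rootEx x y j))) ∧
    iterate F rootEx x y j (.inl 0) = counter F j ∧
    iterate F rootEx x y j (.inl 1) = F.sqrt (F.add 1 1) ∧
    iterate F rootEx x y j (.inl 2) = 1 ∧
    ∀ k, Near (2 ^ q * A + L / 2 ^ j + 4 * u) (a k ^ 2 ^ q)
      (iterate F rootEx x y j (.inr (.inr k))) := by
  have key : ∀ (z : RootVar T → ℝ) (ε : ℝ) (b : Fin N → ℝ), (∀ k, 0 ≤ b k) →
      (∀ k, Near ε (b k) (z (.inr (.inr k)))) →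
      (∀ v, (rootEx v).Defined F (Sum.elim x z)) ∧
      ∀ k, Near (ε / 2 + 2 * u) (√(b k)) ((rootEx (.inr (.inr k))).fl F (Sum.elim x z)) := by
    intro z ε b hb hz
    refine ⟨?_, fun k => ?_⟩
    · rintro (i | m | k)
      · fin_cases i
        · exact ⟨trivial, trivial⟩
        · trivial
        · trivial
      · trivial
      · exact ⟨trivial, (hz k).nonneg (hb k)⟩
    · exact (hz k).sqrt.trans (.of_abs_sub_le hu hu' (F.sqrt_err _ ((hz k).nonneg (hb k))))
  induction j generalizing q with
  | zero =>
    obtain rfl : q = p := by omega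
    exact ⟨(key y _ _ (fun k => pow_nonneg (ha k) _) hy).1, h0, h1, h2,
      fun k => by simpa [iterate] using hy k⟩
  | succ j ih =>
    obtain ⟨-, i0, i1, i2, ih⟩ := ih (q + 1) (by omega)
    have hz := (key _ _ _ (fun k => pow_nonneg (ha k) _) ih).2
    have hz' : ∀ k, Near (2 ^ q * A + L / 2 ^ (j + 1) + 4 * u) (a k ^ 2 ^ q)
        (iterate F rootEx x y (j + 1) (.inr (.inr k))) := fun k => by
      have := hz k
      rw [show 2 ^ (q + 1) = 2 ^ q * 2 from pow_succ 2 q, pow_mul (a k), Real.sqrt_sq (pow_nonneg (ha k) _)] at this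
      refine this.mono (le_of_eq ?_)
      rw [pow_succ, pow_succ]
      field_simp
      ring
    refine ⟨(key _ _ _ (fun k => pow_nonneg (ha k) _) hz').1, ?_, i1, i2, hz'⟩
    change F.mul (iterate F rootEx x y j (.inl 0)) (iterate F rootEx x y j (.inl 1)) = _
    rw [i0, i1]
    rfl

theorem traceEx_near [∀ k, Fintype (T k)] [∀ k, DecidableEq (T k)] {u : ℝ} (F : FloatArith u) (hu : 0 ≤ u)
    (hu' : u ≤ 1 / 2) (x : ι → ℝ) (y : RootVar T → ℝ) (X : ∀ k, Matrix (T k) (T k) ℝ)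
    (hX : ∀ k i j, 0 ≤ X k i j) {ε : ℝ} (hε : 0 ≤ ε)
    (hy : ∀ k i j, Near ε (X k i j) (y (.inr (.inl ⟨k, i, j⟩)))) (k : Fin N) :
    (traceEx (.inr (.inr k))).Defined F (Sum.elim x y) ∧
      Near (ε + Fintype.card (T k) * (2 * u)) (X k).trace
        ((traceEx (.inr (.inr k))).fl F (Sum.elim x y)) := by
  let x' : ι ⊕ RootVar T → ℝ := Sum.elim x fun v => match v with
    | .inr (.inl m) => X m.1 m.2.1 m.2.2
    | v => y v
  let w : ι ⊕ RootVar T → ℝ := Sum.elim 0 fun v => match v with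
    | .inr (.inl _) => ε
    | _ => 0
  have hw : ∀ v, Near (w v) (x' v) (Sum.elim x y v) := by
    rintro (i | i | ⟨k, i, l⟩ | k)
    · exact .refl _
    · exact .refl _
    · exact hy k i l
    · exact .refl _
  have hgood : (traceEx (ι := ι) (.inr (.inr k)) : Ex (ι ⊕ RootVar T)).Nonneg u x' :=
    Ex.Nonneg.fsum fun i => ⟨trivial, hX k i i⟩
  obtain ⟨h, h'⟩ := Ex.near_fl F hu hu' hw _ hgood.1
  refine ⟨h, ?_⟩
  have e : (traceEx (ι := ι) (.inr (.inr k)) : Ex (ι ⊕ RootVar T)).eval u x' = (X k).trace :=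
    Ex.eval_fsum _ _
  rw [e] at h'
  exact h'.mono (Ex.err_fsum_le (by linarith) hε fun i => le_rfl)

theorem quotientEx_near {u : ℝ} (F : FloatArith u) (hu : 0 ≤ u) (hu' : u ≤ 1 / 2) (s : Bool)
    (x : ι → ℝ) (y : RootVar T → ℝ) {d : Fin N → ℝ} (hd : ∀ i, 0 < d i) {ε : ℝ}
    (hy : ∀ k : Fin N, Near ε (∏ i : Fin (k + 1), d (Fin.castLE k.2 i)) (y (.inr (.inr k))))
    (k : Fin N) :
    (quotientEx s k).Defined F (Sum.elim x y) ∧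
      Near (2 * ε + 4 * u) (if s then √(d k) else d k)
        ((quotientEx s k).fl F (Sum.elim x y)) := by
  have hpos : ∀ k : Fin N, 0 < ∏ i : Fin (k + 1), d (Fin.castLE k.2 i) := fun k =>
    Finset.prod_pos fun i _ => hd _
  have hε := (hy k).eps_nonneg
  obtain ⟨q, hq, hqd, hqn⟩ : ∃ q : Ex (ι ⊕ RootVar T),
      quotientEx s k = (if s then .sqrt q else q) ∧ q.Defined F (Sum.elim x y) ∧
      Near (2 * ε + 2 * u) (d k) (q.fl F (Sum.elim x y)) := by
    by_cases h : (k : ℕ) = 0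
    · refine ⟨.var (.inr (.inr (.inr k))), by simp [quotientEx, h], trivial, ?_⟩
      obtain ⟨k, hk⟩ := k
      simp only at h
      subst h
      have := hy ⟨0, hk⟩
      simp only [Fin.prod_univ_succ, Finset.univ_eq_empty, Finset.prod_empty, mul_one] at this
      exact this.mono (by linarith)
    · refine ⟨.div (.var (.inr (.inr (.inr k)))) (.var (.inr (.inr (.inr ⟨k - 1, by omega⟩)))),
        by simp [quotientEx, h], ⟨trivial, trivial, (hy _).ne_zero (hpos _).ne'⟩, ?_⟩
      have hdiv := ((hy k).div (hy ⟨k - 1, by omega⟩)).trans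
        (.of_abs_sub_le hu hu' (F.div_err _ _ ((hy ⟨k - 1, by omega⟩).ne_zero (hpos _).ne')))
      have e : (∏ i : Fin (k + 1), d (Fin.castLE k.2 i)) /
          (∏ i : Fin ((k : ℕ) - 1 + 1), d (Fin.castLE (by omega) i)) = d k := by
        rw [Fin.prod_univ_castSucc, mul_comm, mul_div_assoc]
        have : (∏ i : Fin (k : ℕ), d (Fin.castLE k.2 i.castSucc)) =
            ∏ i : Fin ((k : ℕ) - 1 + 1), d (Fin.castLE (by omega) i) :=
          Fintype.prod_equiv (finCongr (by omega)) _ _ fun i => rfl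
        rw [this, div_self (Finset.prod_pos fun i _ => hd _).ne', mul_one]
        rfl
      rw [e] at hdiv
      exact hdiv.mono (by linarith)
  rw [hq]
  cases s with
  | false => exact ⟨hqd, hqn.mono (by linarith)⟩
  | true =>
    have h0 := hqn.nonneg (hd k).le
    exact ⟨⟨hqd, h0⟩, (hqn.sqrt.trans (.of_abs_sub_le hu hu' (F.sqrt_err _ h0))).mono
      (by linarith)⟩

theorem exists_near_rootProgram [∀ k, Fintype (T k)] [∀ k, DecidableEq (T k)]
    (e : ∀ k, T k → T k → Ex (ι ⊕ RootVar T)) (s : Bool) (c : ℝ) {C : ℝ} (hC : 1 ≤ C) :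
    ∃ E : ℝ, ∀ u, 0 < u → u ≤ 1 / 100 → ∀ F : FloatArith u, ∀ x x' : ι → ℝ,
      (∀ i, Near (u * c) (x i) (x' i)) → ∀ X : ∀ k, Matrix (T k) (T k) ℝ,
      (∀ k i j, 0 ≤ X k i j) → (∀ k i j, (e k i j).Good u (Sum.elim x 0)) →
      (∀ k i j, (e k i j).eval u (Sum.elim x 0) = X k i j) →
      ∀ d : Fin N → ℝ, (∀ i, 0 < d i) →
      (∀ (k : Fin N) (m : ℕ),
        (∏ i : Fin (k + 1), d (Fin.castLE k.2 i)) ^ m ≤ (X k ^ m).trace ∧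
        (X k ^ m).trace ≤ C * (∏ i : Fin (k + 1), d (Fin.castLE k.2 i)) ^ m) →
      ∃ y, (rootProgram e s).Computes F x' y ∧
        ∀ k, Near (u * E) (if s then √(d k) else d k) (y k) := by
  let w : ι ⊕ RootVar T → ℝ := Sum.elim (fun _ => c) 0
  let err := fun m : Σ k, T k × T k => |(e m.1 m.2.1 m.2.2).err 2 w|
  let E₀ : ℝ := ∑ m, err m
  let D : ℝ := ∑ k, (2 + 2 * (Fintype.card (T k) : ℝ))
  have hE₀ : ∀ k i j, (e k i j).err 2 w ≤ E₀ := fun k i j => (le_abs_self _).trans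
    (Finset.single_le_sum (f := err) (fun _ _ => abs_nonneg _) (Finset.mem_univ ⟨k, i, j⟩))
  have hE₀0 : 0 ≤ E₀ := Finset.sum_nonneg fun _ _ => abs_nonneg _
  have hD : ∀ k, 2 + 2 * (Fintype.card (T k) : ℝ) ≤ D := fun k =>
    Finset.single_le_sum (f := fun k => 2 + 2 * (Fintype.card (T k) : ℝ))
      (fun _ _ => by positivity) (Finset.mem_univ k)
  -- The inner sum collects initial errors, squarings and trace, the trace bound, and the roots; the
  -- final quotient doubles it and contributes the last `4`.
  refine ⟨2 * (E₀ + D + Real.log C + 4) + 4, fun u hu hu' F x x' hx X hX hgood heval d hd htr => ?_⟩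
  have hu2 : u ≤ 1 / 2 := by linarith
  have hw : ∀ v, Near (u * w v) (Sum.elim x 0 v) (Sum.elim x' (fun _ : RootVar T => (0 : ℝ)) v) := by
    rintro (i | v)
    · exact hx i
    · simpa [w] using Near.refl 0
  have hinit := fun k i j => Ex.near_fl F hu.le hu2 hw _ (hgood k i j)
  have hadd : 0 ≤ F.add 1 1 := by
    have := abs_le.1 (F.add_err 1 1)
    rw [show (1 : ℝ) + 1 = 2 by norm_num, abs_two] at this
    linarith
  obtain ⟨t₁, ht₁, hold₁⟩ := exec_update F (initEx e)
    (holds_initStore x' : Holds (Program.initStore x' : Store ι (Fin N)) x' _) (by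
      rintro (i | ⟨k, i, j⟩ | k)
      · fin_cases i
        · trivial
        · exact ⟨⟨trivial, trivial⟩, hadd⟩
        · trivial
      · exact (hinit k i j).1
      · trivial)
  obtain ⟨p, hlt, hge, hp⟩ := exists_least_one_le_counter F hu hu'
  have hsq := squareEx_iterate F hu.le hu2 x'
    (fun v => (initEx e v).fl F (Sum.elim x' fun _ => 0)) rfl rfl rfl X hX hD
    (show D ≤ E₀ + D by linarith) (fun k i j => by
      have := (hinit k i j).2
      rw [mul_comm 2 u, Ex.err_smul hu.le, heval] at this
      exact this.mono (by rw [add_sub_cancel_right]; exact mul_le_mul_of_nonneg_left (hE₀ k i j) hu.le))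
  obtain ⟨t₂, ht₂, hold₂⟩ := exec_while_update F squareEx (.inl 0) (.inl 2) p
    (iterate F squareEx x' _) (fun _ _ => rfl) (fun j _ => (hsq j).1)
    (fun j hj => by rw [(hsq j).2.1, (hsq j).2.2.2.1]; exact hlt j hj)
    (by rw [(hsq p).2.1, (hsq p).2.2.2.1]; exact hge) hold₁
  have hED : 1 * (E₀ + D) ≤ 2 ^ p * (E₀ + D) :=
    mul_le_mul_of_nonneg_right (one_le_pow₀ (by norm_num))
      (add_nonneg hE₀0 (Finset.sum_nonneg fun _ _ => by positivity))
  have htrace := traceEx_near F hu.le hu2 x' _ (fun k => X k ^ 2 ^ p)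
    (fun k => pow_apply_nonneg (hX k) _) (mul_nonneg hu.le (by linarith)) (hsq p).2.2.2.2
  obtain ⟨t₃, ht₃, hold₃⟩ := exec_update F traceEx hold₂ (by
      rintro (i | m | k)
      · fin_cases i <;> trivial
      · trivial
      · exact (htrace k).1)
  have hprod : ∀ k : Fin N, 0 < ∏ i : Fin (k + 1), d (Fin.castLE k.2 i) := fun k =>
    Finset.prod_pos fun i _ => hd _
  have hL : 0 ≤ Real.log C := Real.log_nonneg hC
  have hrt := rootEx_iterate F hu.le hu2 x'
    (fun v => (traceEx v).fl F (Sum.elim x' (iterate F squareEx x'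
      (fun v => (initEx e v).fl F (Sum.elim x' fun _ => 0)) p))) rfl (hsq p).2.2.1 (hsq p).2.2.2.1
    _ (fun k => (hprod k).le) (A := u * (E₀ + D)) (L := Real.log C) p (fun k => by
      have hpos := pow_pos (hprod k) (2 ^ p)
      have h₁ : Near (Real.log C) ((∏ i : Fin (k + 1), d (Fin.castLE k.2 i)) ^ 2 ^ p)
          (X k ^ 2 ^ p).trace := by
        refine Near.of_bounds hpos ?_ ?_
        · refine le_trans (mul_le_of_le_one_right hpos.le ?_) (htr k _).1
          exact Real.exp_le_one_iff.2 (by linarith)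
        · rw [Real.exp_log (by linarith), mul_comm]
          exact (htr k _).2
      -- The slack `-D` kept by the squarings also pays for the additions in the trace.
      refine (h₁.trans (htrace k).2).mono ?_
      have := mul_le_mul_of_nonneg_left (hD k) hu.le
      nlinarith)
  -- The counter was reset to `u` and the operations of `F` are functions, so this loop makes
  -- exactly as many steps as the squaring loop.
  obtain ⟨t₄, ht₄, hold₄⟩ := exec_while_update F rootEx (.inl 0) (.inl 2) p
    (iterate F rootEx x' _) (fun _ _ => rfl) (fun j hj => (hrt j (p - j) (by omega)).1)
    (fun j hj => by
      rw [(hrt j (p - j) (by omega)).2.1, (hrt j (p - j) (by omega)).2.2.2.1]; exact hlt j hj)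
    (by rw [(hrt p 0 rfl).2.1, (hrt p 0 rfl).2.2.2.1]; exact hge) hold₃
  have hquot := quotientEx_near F hu.le hu2 s x' _ hd (ε := u * (E₀ + D + Real.log C + 4))
    (fun k => by
      have h := (hrt p 0 rfl).2.2.2.2 k
      rw [pow_zero, one_mul, pow_zero, pow_one] at h
      refine h.mono ?_
      have := mul_le_mul_of_nonneg_left hp hL
      rw [div_eq_mul_one_div]
      linarith)
  obtain ⟨t₅, ht₅, hout⟩ := exec_output F (quotientEx (T := T) s) hold₄ fun k => (hquot k).1
  refine ⟨_, ⟨t₅, .seq _ _ _ _ _ ht₁ (.seq _ _ _ _ _ ht₂ (.seq _ _ _ _ _ ht₃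
    (.seq _ _ _ _ _ ht₄ ht₅))), hout⟩, fun k => (hquot k).2.mono (by linarith)⟩

end RootProgram

end LatticePath
namespace LatticePath

open Matrix

/-! ### The inverse of the lattice path matrix -/

section Inverse

/-- The scaled Pascal matrices form a one-parameter group; with `y = -x` this inverts them.
Induction on the row uses Pascal's rule on both factors. -/
theorem sum_pascalEntry_mul (x y : ℝ) (M i j : ℕ) (hi : i < M) :
    ∑ k ∈ Finset.range M, pascalEntry x i k * pascalEntry y k j = pascalEntry (x + y) i j := by
  induction i generalizing j M with
  | zero =>
    rw [Finset.sum_eq_single_of_mem 0 (by simpa using hi) fun k _ hk => by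
      rw [pascalEntry_of_lt x (Nat.pos_of_ne_zero hk), zero_mul]]
    cases j <;> simp [pascalEntry]
  | succ i ih =>
    obtain ⟨M, rfl⟩ : ∃ m, M = m + 1 := ⟨M - 1, by omega⟩
    have h := ih (M + 1) j (by omega)
    rw [Finset.sum_range_succ'] at h ⊢
    have h' := ih M j (by omega)
    cases j with
    | zero =>
      simp only [pascalEntry_succ_succ, pascalEntry_succ_zero, add_mul, Finset.sum_add_distrib,
        mul_assoc, mul_left_comm _ y, ← Finset.mul_sum] at h ⊢
      rw [h']
      linear_combination x * h
    | succ j =>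
      have h'' := ih M j (by omega)
      simp only [pascalEntry_succ_succ, pascalEntry_succ_zero, add_mul, mul_add,
        Finset.sum_add_distrib, mul_assoc, mul_left_comm _ y, ← Finset.mul_sum] at h ⊢
      rw [h', h'', pascalEntry_of_lt y (Nat.succ_pos j)] at *
      linear_combination x * h

/-- The absolute values of the entries of the inverse of the lattice path matrix. -/
noncomputable def absInv (n : ℕ) (a b q : ℝ) (i j : Fin (n + 1)) : ℝ :=
  (∑ k : Fin (n + 1), ((k : ℕ).choose i * (k : ℕ).choose j : ℕ) / (q / (a * b)) ^ (k : ℕ)) /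
    (a ^ (i : ℕ) * b ^ (j : ℕ))

/-- The inverse of the Pascal matrix. -/
noncomputable def pascalInv (N : ℕ) : Matrix (Fin N) (Fin N) ℝ :=
  of fun i j => (-1) ^ ((i : ℕ) + j) * ((i : ℕ).choose j : ℝ)

theorem pascal_mul_pascalInv (N : ℕ) : pascal N * pascalInv N = 1 := by
  ext i j
  have h := sum_pascalEntry_mul 1 (-1) N i j i.2
  rw [← Fin.sum_univ_eq_sum_range (fun k => pascalEntry 1 i k * pascalEntry (-1) k j)] at h
  rw [mul_apply, one_apply]
  have e : ∀ k : Fin N, pascal N i k * pascalInv N k j =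
      pascalEntry 1 i k * pascalEntry (-1) k j := fun k => by
    simp only [pascal, pascalInv, pascalEntry, of_apply, one_pow, mul_one]
    rcases le_or_gt (j : ℕ) k with hk | hk
    · obtain ⟨m, hm⟩ := Nat.exists_eq_add_of_le hk
      rw [hm, Nat.add_sub_cancel_left, show (j : ℕ) + m + j = 2 * j + m by ring, pow_add _ (2 * _),
        (even_two_mul _).neg_one_pow]
      ring
    · simp [Nat.choose_eq_zero_of_lt hk]
  rw [Finset.sum_congr rfl fun k _ => e k, h]
  simp only [pascalEntry, add_neg_cancel]
  rcases lt_trichotomy i j with hij | rfl | hij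
  · simp [hij.ne, Nat.choose_eq_zero_of_lt (Fin.lt_def.1 hij)]
  · simp
  · have : (i : ℕ) - j ≠ 0 := by have := Fin.lt_def.1 hij; omega
    simp [hij.ne', this]

/-- In the product of inverse factors the signs are `(-1)^(k+i) (-1)^(k+j) = (-1)^(i+j)`,
independent of the summation index, so each entry is a sum of terms of one sign. -/
theorem Lp_mul_inverse (n : ℕ) {a b q : ℝ} (ha : 0 < a) (hb : 0 < b) (hq : 0 < q) :
    Lp n a b (q - a * b) *
      (of fun i j : Fin (n + 1) => (-1) ^ ((i : ℕ) + j) * absInv n a b q i j) = 1 := by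
  have hpow : ∀ x : ℝ, 0 < x → (diagonal fun i : Fin (n + 1) => x ^ (i : ℕ)) *
      (diagonal fun i : Fin (n + 1) => (x ^ (i : ℕ))⁻¹) = 1 := fun x hx => by
    rw [diagonal_mul_diagonal, ← diagonal_one]
    congr 1
    ext i
    exact mul_inv_cancel₀ (pow_pos hx _).ne'
  have hinv : (of fun i j : Fin (n + 1) => (-1) ^ ((i : ℕ) + j) * absInv n a b q i j) =
      (diagonal fun i : Fin (n + 1) => (a ^ (i : ℕ))⁻¹) * ((pascalInv (n + 1))ᵀ *
        (diagonal fun i : Fin (n + 1) => ((q / (a * b)) ^ (i : ℕ))⁻¹) * pascalInv (n + 1)) *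
        diagonal fun i : Fin (n + 1) => (b ^ (i : ℕ))⁻¹ := by
    ext i j
    rw [mul_diagonal, diagonal_mul, mul_apply, of_apply, absInv, Finset.sum_div, Finset.mul_sum,
      Finset.mul_sum, Finset.sum_mul]
    refine Finset.sum_congr rfl fun k _ => ?_
    rw [mul_diagonal, transpose_apply]
    simp only [pascalInv, of_apply]
    have e : (-1 : ℝ) ^ ((i : ℕ) + j) = (-1) ^ ((k : ℕ) + i) * (-1) ^ ((k : ℕ) + j) := by
      rw [← pow_add, show (k : ℕ) + i + (k + j) = 2 * k + (i + j) by ring, pow_add _ (2 * _),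
        (even_two_mul _).neg_one_pow, one_mul]
    rw [e]
    push_cast
    field_simp
  have hP := pascal_mul_pascalInv (n + 1)
  have hP' : (pascal (n + 1))ᵀ * (pascalInv (n + 1))ᵀ = 1 := by
    rw [← transpose_mul, mul_eq_one_comm.1 hP, transpose_one]
  rw [Lp_eq_mul n ha.ne' hb.ne', hinv]
  have hδ := hpow _ (div_pos hq (mul_pos ha hb))
  have key : ∀ (A A' P P' Q Q' B B' D D' : Matrix (Fin (n + 1)) (Fin (n + 1)) ℝ), A * A' = 1 →
      B * B' = 1 → D * D' = 1 → P * P' = 1 → Q * Q' = 1 →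
      B * (P * D * Q) * A * (A' * (Q' * D' * P') * B') = 1 := by
    intro A A' P P' Q Q' B B' D D' hA hB hD hP hQ
    calc B * (P * D * Q) * A * (A' * (Q' * D' * P') * B') =
          B * (P * (D * (Q * (A * A') * Q') * D') * P') * B' := by simp only [Matrix.mul_assoc]
      _ = 1 := by rw [hA, Matrix.mul_one, hQ, Matrix.mul_one, hD, Matrix.mul_one, hP,
        Matrix.mul_one, hB]
  exact key _ _ _ _ _ _ _ _ _ _ (hpow a ha) (hpow b hb) hδ hP hP'

/-! ### Nonsingularity and the positive real spectrum. -/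

theorem det_Lp_ne_zero (n : ℕ) {a b q : ℝ} (ha : 0 < a) (hb : 0 < b) (hq : 0 < q) :
    (Lp n a b (q - a * b)).det ≠ 0 := fun h => by
  have := congrArg det (Lp_mul_inverse n ha hb hq)
  rw [det_mul, h, zero_mul, det_one] at this
  exact zero_ne_one this

/-- The eigenvalues of the lattice path matrix are real and positive. -/
theorem exists_diagonalization_Lp (n : ℕ) {a b q : ℝ} (ha : 0 < a) (hb : 0 < b) (hq : 0 < q) :
    ∃ (d : Fin (n + 1) → ℝ) (Z Z' : Matrix (Fin (n + 1)) (Fin (n + 1)) ℝ), Antitone d ∧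
      (∀ i, 0 < d i) ∧ Z' * Z = 1 ∧ Lp n a b (q - a * b) = Z * diagonal d * Z' := by
  have hdet := det_Lp_ne_zero n ha hb hq
  -- Conjugation by powers of `t / a` replaces both outer scalings `b^i` and `a^j` by powers of `t`,
  -- which makes the matrix symmetric; splitting `δ` as `√δ * √δ` exhibits it as `RᵀR`.
  set t := √(a * b)
  have ht : 0 < t := Real.sqrt_pos.2 (mul_pos ha hb)
  have htt : t * t = a * b := Real.mul_self_sqrt (mul_pos ha hb).le
  set δ := q / (a * b)
  have hδ : √δ * √δ = δ := Real.mul_self_sqrt (div_pos hq (mul_pos ha hb)).le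
  let D : ℝ → Matrix (Fin (n + 1)) (Fin (n + 1)) ℝ := fun x => diagonal fun i => x ^ (i : ℕ)
  have hD : ∀ x y, D x * D y = D (x * y) := fun x y => by
    simp only [D, diagonal_mul_diagonal, ← mul_pow]
  have hDT : ∀ x, (D x)ᵀ = D x := fun x => diagonal_transpose _
  have hD1 : D 1 = 1 := by simp [D]
  set R := D (√δ) * (pascal (n + 1))ᵀ * D t with hR
  have hA : Lp n a b (q - a * b) = D (t / a) * (Rᵀ * R) * D (a / t) := by
    have h₁ : D b = D (t / a) * D t := by
      rw [hD, div_mul_eq_mul_div, htt, mul_div_cancel_left₀ _ ha.ne']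
    have h₂ : D a = D t * D (a / t) := by rw [hD, mul_div_cancel₀ _ ht.ne']
    have h₃ : D δ = D (√δ) * D (√δ) := by rw [hD, hδ]
    have e : Lp n a b (q - a * b) = D b * (pascal (n + 1) * D δ * (pascal (n + 1))ᵀ) * D a :=
      Lp_eq_mul n ha.ne' hb.ne'
    rw [e, h₁, h₂, h₃, hR]
    simp only [transpose_mul, hDT, transpose_transpose, Matrix.mul_assoc]
  have hRdet : R.det ≠ 0 := fun h => hdet (by rw [hA]; simp [det_mul, h])
  obtain ⟨Z, hZ, hRZ⟩ := exists_diagonalization_transpose_mul_self R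
  refine ⟨fun i => (toEuclideanLin R).singularValues i ^ 2, D (t / a) * Z, Zᵀ * D (a / t),
    fun i j hij => pow_le_pow_left₀ (LinearMap.singularValues_nonneg _ _)
      (LinearMap.singularValues_antitone _ hij) 2,
    fun i => pow_pos (singularValues_pos_of_det_ne_zero hRdet i) 2, ?_, ?_⟩
  · rw [Matrix.mul_assoc, ← Matrix.mul_assoc (D (a / t)), hD,
      show a / t * (t / a) = 1 by field_simp, hD1, Matrix.one_mul, hZ]
  · rw [hA, hRZ]
    simp only [Matrix.mul_assoc]

theorem charpoly_eq_prod_of_diagonalization {N : ℕ} {A Z Z' : Matrix (Fin N) (Fin N) ℝ}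
    {d : Fin N → ℝ} (h : Z' * Z = 1) (hA : A = Z * diagonal d * Z') :
    A.charpoly = ∏ i, (Polynomial.X - Polynomial.C (d i)) := by
  rw [hA, charpoly_mul_comm, ← Matrix.mul_assoc, h, Matrix.one_mul, charpoly_diagonal]

end Inverse

end LatticePath
namespace LatticePath

open Matrix

/-! ### Programs for the lattice path matrix -/

section Programs

variable {V : Type} {n : ℕ} {u : ℝ}

/-- An expression with the sign `(-1)^m`. -/
def Ex.signed (m : ℕ) (e : Ex V) : Ex V := if Even m then e else .neg e

theorem Ex.eval_signed (x : V → ℝ) (m : ℕ) (e : Ex V) :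
    (e.signed m).eval u x = (-1) ^ m * e.eval u x := by
  rcases Nat.even_or_odd m with h | h
  · simp [Ex.signed, h]
  · simp [Ex.signed, Nat.not_even_iff_odd.2 h, h.neg_one_pow, Ex.eval]

theorem Ex.Good.signed {x : V → ℝ} {e : Ex V} (h : e.Good u x) (m : ℕ) :
    (e.signed m).Good u x := by
  rw [Ex.signed]
  split_ifs <;> exact h

/-- A minor of the lattice path matrix. -/
noncomputable def compoundEx {k : ℕ} (a b q : Ex V) (r c : Fin k ↪o Fin (n + 1)) : Ex V :=
  .mul (.mul (.pow b (weight r)) (.fsum fun s : Fin k ↪o Fin (n + 1) =>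
    .mul (.nat (pascalMinor r s * pascalMinor c s)) (.pow (.div q (.mul a b)) (weight s))))
    (.pow a (weight c))

/-- A minor of the Gram matrix of the lattice path matrix. -/
noncomputable def gramEx {k : ℕ} (a b q : Ex V) (r c : Fin k ↪o Fin (n + 1)) : Ex V :=
  .fsum fun s => .mul (compoundEx a b q s r) (compoundEx a b q s c)

/-- The absolute value of an entry of the inverse. -/
noncomputable def absInvEx (a b q : Ex V) (i j : Fin (n + 1)) : Ex V :=
  .div (.fsum fun k : Fin (n + 1) => .div (.nat ((k : ℕ).choose i * (k : ℕ).choose j))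
    (.pow (.div q (.mul a b)) k)) (.mul (.pow a i) (.pow b j))

/-- The expression is positive and evaluated without cancellation. -/
def Ex.Pos (u : ℝ) (x : V → ℝ) (e : Ex V) : Prop := e.Good u x ∧ 0 < e.eval u x

theorem Ex.Pos.nonneg {x : V → ℝ} {e : Ex V} (h : e.Pos u x) : e.Nonneg u x := ⟨h.1, h.2.le⟩

variable {x : V → ℝ} {a b q : Ex V}

theorem compoundEx_spec (ha : a.Pos u x) (hb : b.Pos u x) (hq : q.Pos u x) {k : ℕ}
    (r c : Fin k ↪o Fin (n + 1)) :
    (compoundEx a b q r c).Nonneg u x ∧ (compoundEx a b q r c).eval u x =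
      compound k (Lp n (a.eval u x) (b.eval u x)
        (q.eval u x - a.eval u x * b.eval u x)) r c := by
  constructor
  · exact ((hb.nonneg.pow _).mul (.fsum fun s => (Ex.Nonneg.nat _).mul
      ((hq.nonneg.div (ha.nonneg.mul hb.nonneg) (mul_pos ha.2 hb.2).ne').pow _))).mul
      (ha.nonneg.pow _)
  · rw [compound_Lp n ha.2.ne' hb.2.ne']
    simp only [compoundEx, Ex.eval, Ex.eval_pow, Ex.eval_fsum, Ex.eval_nat]

theorem gramEx_spec (ha : a.Pos u x) (hb : b.Pos u x) (hq : q.Pos u x) {k : ℕ}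
    (r c : Fin k ↪o Fin (n + 1)) :
    (gramEx a b q r c).Nonneg u x ∧ (gramEx a b q r c).eval u x =
      compound k ((Lp n (a.eval u x) (b.eval u x) (q.eval u x - a.eval u x * b.eval u x))ᵀ *
        Lp n (a.eval u x) (b.eval u x) (q.eval u x - a.eval u x * b.eval u x)) r c := by
  have h := fun s r : Fin k ↪o Fin (n + 1) => compoundEx_spec ha hb hq s r
  constructor
  · exact .fsum fun s => (h s r).1.mul (h s c).1
  · rw [compound_mul, compound_transpose, mul_apply, gramEx, Ex.eval_fsum]
    simp only [Ex.eval, (h _ _).2, transpose_apply]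

theorem absInvEx_spec (ha : a.Pos u x) (hb : b.Pos u x) (hq : q.Pos u x) (i j : Fin (n + 1)) :
    (absInvEx a b q i j).Nonneg u x ∧ (absInvEx a b q i j).eval u x =
      absInv n (a.eval u x) (b.eval u x) (q.eval u x) i j := by
  constructor
  · refine Ex.Nonneg.div (.fsum fun k => (Ex.Nonneg.nat _).div
      ((hq.nonneg.div (ha.nonneg.mul hb.nonneg) (mul_pos ha.2 hb.2).ne').pow _) ?_)
      ((ha.nonneg.pow _).mul (hb.nonneg.pow _)) ?_
    · rw [Ex.eval_pow]
      exact (pow_pos (div_pos hq.2 (mul_pos ha.2 hb.2)) _).ne'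
    · simp only [Ex.eval, Ex.eval_pow]
      exact (mul_pos (pow_pos ha.2 _) (pow_pos hb.2 _)).ne'
  · simp only [absInvEx, absInv, Ex.eval, Ex.eval_pow, Ex.eval_fsum, Ex.eval_nat]

/-- The bidiagonal decomposition. -/
def bdEx (n : ℕ) (ij : Fin (n + 1) × Fin (n + 1)) : Ex (Fin 3) :=
  if ij.1 = ij.2 then .pow (.add (.mul (.var 0) (.var 1)) (.var 2)) ij.1
  else if ij.2 < ij.1 then .var 1 else .var 0

theorem bdEx_subtractionFree (ij : Fin (n + 1) × Fin (n + 1)) : (bdEx n ij).SubtractionFree := by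
  rw [bdEx]
  split_ifs
  · exact Ex.SubtractionFree.pow (e := .add (.mul (.var 0) (.var 1)) (.var 2))
      ⟨⟨trivial, trivial⟩, trivial⟩ _
  · trivial
  · trivial

theorem bdEx_spec {α β γ : ℝ} (hα : 0 < α) (hβ : 0 < β) (hγ : 0 ≤ γ)
    (ij : Fin (n + 1) × Fin (n + 1)) :
    (bdEx n ij).Good u ![α, β, γ] ∧
      (bdEx n ij).eval u ![α, β, γ] = latticeBD n α β γ ij.1 ij.2 := by
  have h0 : (Ex.var 0 : Ex (Fin 3)).Nonneg u ![α, β, γ] := ⟨trivial, hα.le⟩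
  have h1 : (Ex.var 1 : Ex (Fin 3)).Nonneg u ![α, β, γ] := ⟨trivial, hβ.le⟩
  have h2 : (Ex.var 2 : Ex (Fin 3)).Nonneg u ![α, β, γ] := ⟨trivial, hγ⟩
  simp only [bdEx, latticeBD, of_apply]
  split_ifs
  · exact ⟨(((h0.mul h1).add h2).pow _).1, by simp [Ex.eval_pow, Ex.eval]⟩
  · exact ⟨h1.1, rfl⟩
  · exact ⟨h0.1, rfl⟩

theorem exists_near_bd (n : ℕ) :
    ∃ (p : Program (Fin 3) (Fin (n + 1) × Fin (n + 1))) (E : ℝ), p.SubtractionFree ∧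
      ∀ u, 0 ≤ u → u ≤ 1 / 2 → ∀ F : FloatArith u, ∀ α β γ : ℝ, 0 < α → 0 < β → 0 ≤ γ →
      ∃ y, p.Computes F ![α, β, γ] y ∧
        ∀ ij, Near (u * E) (latticeBD n α β γ ij.1 ij.2) (y ij) := by
  obtain ⟨E, hE⟩ := Ex.exists_near_straightLine (bdEx n) 0
  refine ⟨Ex.straightLine (bdEx n), E, Ex.subtractionFree_assign _ _ _ _ bdEx_subtractionFree,
    fun u hu hu' F α β γ hα hβ hγ => ?_⟩
  obtain ⟨y, hy, hn⟩ := hE u hu hu' F ![α, β, γ] ![α, β, γ]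
    (fun i => by simpa using Near.refl _) fun k => (bdEx_spec hα hβ hγ k).1
  exact ⟨y, hy, fun ij => (bdEx_spec hα hβ hγ ij).2 ▸ hn ij⟩

/-! ### Programs that read the bidiagonal decomposition. -/

/-- The lattice path matrix with the bidiagonal decomposition `B`. -/
noncomputable def ofBD (n : ℕ) (B : Fin (n + 1) × Fin (n + 1) → ℝ) :
    Matrix (Fin (n + 1)) (Fin (n + 1)) ℝ :=
  Lp n (B (0, 1)) (B (1, 0)) (B (1, 1) - B (0, 1) * B (1, 0))

/-- The entries that determine the matrix are positive. -/
structure PosBD (B : Fin (n + 1) × Fin (n + 1) → ℝ) : Prop where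
  left : 0 < B (0, 1)
  right : 0 < B (1, 0)
  pivot : 0 < B (1, 1)

theorem latticeBD_pos {α β γ : ℝ} (hα : 0 < α) (hβ : 0 < β) (hγ : 0 ≤ γ) (i j : Fin (n + 1)) :
    0 < latticeBD n α β γ i j := by
  have : 0 < α * β + γ := by positivity
  simp only [latticeBD, of_apply]
  split_ifs <;> positivity

theorem posBD_latticeBD {α β γ : ℝ} (hα : 0 < α) (hβ : 0 < β) (hγ : 0 ≤ γ) :
    PosBD fun ij : Fin (n + 1) × Fin (n + 1) => latticeBD n α β γ ij.1 ij.2 :=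
  ⟨latticeBD_pos hα hβ hγ _ _, latticeBD_pos hα hβ hγ _ _, latticeBD_pos hα hβ hγ _ _⟩

theorem ofBD_latticeBD (α β γ : ℝ) :
    ofBD n (fun ij => latticeBD n α β γ ij.1 ij.2) = Lp n α β γ := by
  -- For `n = 0` the index `1` is `0` in `Fin 1`, so all three entries read are the single pivot
  -- `1`; the matrix is `(1)` whatever the parameters.
  rcases n with _ | n
  · ext i j
    rw [Fin.fin_one_eq_zero i, Fin.fin_one_eq_zero j]
    simp [ofBD, Lp, entry]
  · have h : (0 : Fin (n + 1 + 1)) < 1 := Fin.zero_lt_one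
    simp [ofBD, latticeBD, h.ne]

/-- Eigenvalues (`s = false`) or singular values (`s = true`). -/
theorem exists_near_values (n : ℕ) (s : Bool) (c : ℝ) :
    ∃ (p : Program (Fin (n + 1) × Fin (n + 1)) (Fin (n + 1))) (E : ℝ),
      ∀ u, 0 < u → u ≤ 1 / 100 → ∀ F : FloatArith u,
      ∀ B B' : Fin (n + 1) × Fin (n + 1) → ℝ, (∀ ij, Near (u * c) (B ij) (B' ij)) → PosBD B →
      ∀ (d : Fin (n + 1) → ℝ) (Z Z' : Matrix (Fin (n + 1)) (Fin (n + 1)) ℝ), Antitone d →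
      (∀ i, 0 < d i) → Z' * Z = 1 →
      (if s then (ofBD n B)ᵀ * ofBD n B else ofBD n B) = Z * diagonal d * Z' →
      ∃ y, p.Computes F B' y ∧ ∀ k, Near (u * E) (if s then √(d k) else d k) (y k) := by
  let T : Fin (n + 1) → Type := fun k => Fin ((k : ℕ) + 1) ↪o Fin (n + 1)
  let v : Fin (n + 1) × Fin (n + 1) → Ex (Fin (n + 1) × Fin (n + 1) ⊕ RootVar T) :=
    fun ij => .var (.inl ij)
  let e : ∀ k, T k → T k → Ex (Fin (n + 1) × Fin (n + 1) ⊕ RootVar T) := fun k r t =>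
    if s then gramEx (v (0, 1)) (v (1, 0)) (v (1, 1)) r t
    else compoundEx (v (0, 1)) (v (1, 0)) (v (1, 1)) r t
  let C : ℝ := 1 + ∑ k, (Fintype.card (T k) : ℝ)
  have hC : ∀ k, (Fintype.card (T k) : ℝ) ≤ C := fun k => by
    have := Finset.single_le_sum (f := fun k => (Fintype.card (T k) : ℝ))
      (fun _ _ => by positivity) (Finset.mem_univ k)
    simp only [C]
    linarith
  have hC1 : 1 ≤ C := by
    have : 0 ≤ ∑ k, (Fintype.card (T k) : ℝ) := by positivity
    simp only [C]
    linarith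
  obtain ⟨E, hE⟩ := exists_near_rootProgram e s c hC1
  refine ⟨rootProgram e s, E, fun u hu hu' F B B' hB hpos d Z Z' hd hd0 hZ hA => ?_⟩
  have h01 : (v (0, 1)).Pos u (Sum.elim B 0) := ⟨trivial, hpos.left⟩
  have h10 : (v (1, 0)).Pos u (Sum.elim B 0) := ⟨trivial, hpos.right⟩
  have h11 : (v (1, 1)).Pos u (Sum.elim B 0) := ⟨trivial, hpos.pivot⟩
  have he : ∀ k r t, (e k r t).Nonneg u (Sum.elim B 0) ∧ (e k r t).eval u (Sum.elim B 0) =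
      compound ((k : ℕ) + 1) (if s then (ofBD n B)ᵀ * ofBD n B else ofBD n B) r t := by
    intro k r t
    cases s with
    | false => exact compoundEx_spec h01 h10 h11 r t
    | true => exact gramEx_spec h01 h10 h11 r t
  refine hE u hu hu' F B B' hB
    (fun k => compound ((k : ℕ) + 1) (if s then (ofBD n B)ᵀ * ofBD n B else ofBD n B))
    (fun k r t => (he k r t).2 ▸ (he k r t).1.2) (fun k r t => (he k r t).1.1)
    (fun k r t => (he k r t).2) d hd0 fun k m => ?_
  obtain ⟨h₁, h₂⟩ := trace_compound_pow_bounds hZ hA hd hd0 k.2 m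
  exact ⟨h₁, h₂.trans (mul_le_mul_of_nonneg_right (hC k)
    (pow_nonneg (Finset.prod_nonneg fun i _ => (hd0 _).le) _))⟩

theorem exists_near_inverse (n : ℕ) (c : ℝ) :
    ∃ (p : Program (Fin (n + 1) × Fin (n + 1)) (Fin (n + 1) × Fin (n + 1))) (E : ℝ),
      ∀ u, 0 ≤ u → u ≤ 1 / 2 → ∀ F : FloatArith u,
      ∀ B B' : Fin (n + 1) × Fin (n + 1) → ℝ, (∀ ij, Near (u * c) (B ij) (B' ij)) → PosBD B →
      ∃ y, p.Computes F B' y ∧ ∀ ij, Near (u * E) ((ofBD n B)⁻¹ ij.1 ij.2) (y ij) := by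
  let e : Fin (n + 1) × Fin (n + 1) → Ex (Fin (n + 1) × Fin (n + 1)) := fun ij =>
    (absInvEx (.var (0, 1)) (.var (1, 0)) (.var (1, 1)) ij.1 ij.2).signed (ij.1 + ij.2)
  obtain ⟨E, hE⟩ := Ex.exists_near_straightLine e c
  refine ⟨Ex.straightLine e, E, fun u hu hu' F B B' hB hpos => ?_⟩
  have h01 : (Ex.var (0, 1)).Pos u B := ⟨trivial, hpos.left⟩
  have h10 : (Ex.var (1, 0)).Pos u B := ⟨trivial, hpos.right⟩
  have h11 : (Ex.var (1, 1)).Pos u B := ⟨trivial, hpos.pivot⟩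
  have h := fun ij : Fin (n + 1) × Fin (n + 1) => absInvEx_spec h01 h10 h11 ij.1 ij.2
  obtain ⟨y, hy, hn⟩ := hE u hu hu' F B B' hB fun ij => (h ij).1.1.signed _
  refine ⟨y, hy, fun ij => ?_⟩
  have := hn ij
  rw [Ex.eval_signed, (h ij).2] at this
  rw [ofBD, inv_eq_right_inv (Lp_mul_inverse n hpos.left hpos.right hpos.pivot)]
  exact this

/-- By the checkerboard signs, `(-1)^i x i` is the sum over `j` of `absInv i j * ((-1)^j b j)`,
whose terms all have one sign when `b` alternates. -/
theorem exists_near_solve (n : ℕ) (c : ℝ) :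
    ∃ (p : Program ((Fin (n + 1) × Fin (n + 1)) ⊕ Fin (n + 1)) (Fin (n + 1))) (E : ℝ),
      ∀ u, 0 ≤ u → u ≤ 1 / 2 → ∀ F : FloatArith u,
      ∀ B B' : Fin (n + 1) × Fin (n + 1) → ℝ, (∀ ij, Near (u * c) (B ij) (B' ij)) → PosBD B →
      ∀ b x : Fin (n + 1) → ℝ, AlternatingSigns b → (ofBD n B).mulVec x = b →
      ∃ y, p.Computes F (Sum.elim B' b) y ∧ ∀ i, Near (u * E) (x i) (y i) := by
  let v : Fin (n + 1) × Fin (n + 1) → Ex (Fin (n + 1) × Fin (n + 1) ⊕ Fin (n + 1)) :=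
    fun ij => .var (.inl ij)
  let m : Fin (n + 1) → Fin (n + 1) → Ex (Fin (n + 1) × Fin (n + 1) ⊕ Fin (n + 1)) := fun i j =>
    .mul (absInvEx (v (0, 1)) (v (1, 0)) (v (1, 1)) i j) ((Ex.var (.inr j)).signed j)
  -- The entries of `b` are exact, so the common bound on the data errors must be nonnegative as
  -- well as at least `c`.
  obtain ⟨E, hE⟩ := Ex.exists_near_straightLine (fun i => (Ex.fsum (m i)).signed i) (max c 0)
  refine ⟨Ex.straightLine fun i => (Ex.fsum (m i)).signed i, E, fun u hu hu' F B B' hB hpos b x hb hx => ?_⟩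
  have h01 : (v (0, 1)).Pos u (Sum.elim B b) := ⟨trivial, hpos.left⟩
  have h10 : (v (1, 0)).Pos u (Sum.elim B b) := ⟨trivial, hpos.right⟩
  have h11 : (v (1, 1)).Pos u (Sum.elim B b) := ⟨trivial, hpos.pivot⟩
  have h := fun i j : Fin (n + 1) => absInvEx_spec h01 h10 h11 i j
  have hev : ∀ i j, (m i j).eval u (Sum.elim B b) =
      absInv n (B (0, 1)) (B (1, 0)) (B (1, 1)) i j * ((-1) ^ (j : ℕ) * b j) := fun i j => by
    rw [Ex.eval, (h i j).2, Ex.eval_signed]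
    rfl
  have habs : ∀ i j, 0 ≤ absInv n (B (0, 1)) (B (1, 0)) (B (1, 1)) i j := fun i j => by
    have := (h i j).1.2
    rw [(h i j).2] at this
    exact this
  have hgood : ∀ i, (Ex.fsum (m i)).Good u (Sum.elim B b) := fun i => by
    have hg : ∀ j, (m i j).Good u (Sum.elim B b) := fun j =>
      ⟨(h i j).1.1, Ex.Good.signed (e := .var (Sum.inr j)) trivial _⟩
    rcases hb with hb | hb
    · refine Ex.good_fsum hg one_ne_zero fun j => ?_
      rw [one_mul, hev]
      exact mul_nonneg (habs i j) (hb j)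
    · refine Ex.good_fsum hg (σ := -1) (by norm_num) fun j => ?_
      rw [hev]
      nlinarith [mul_nonneg (habs i j) (neg_nonneg.2 (hb j))]
  obtain ⟨y, hy, hn⟩ := hE u hu hu' F (Sum.elim B b) (Sum.elim B' b) (by
    rintro (ij | j)
    · exact (hB ij).mono (mul_le_mul_of_nonneg_left (le_max_left _ _) hu)
    · exact (Near.refl _).mono (mul_nonneg hu (le_max_right _ _))) fun i => (hgood i).signed _
  refine ⟨y, hy, fun i => ?_⟩
  have hxi : x i = (-1) ^ (i : ℕ) * (Ex.fsum (m i)).eval u (Sum.elim B b) := by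
    have hinv := mul_eq_one_comm.1 (Lp_mul_inverse n hpos.left hpos.right hpos.pivot)
    have : x = (of fun i j : Fin (n + 1) => (-1) ^ ((i : ℕ) + j) *
        absInv n (B (0, 1)) (B (1, 0)) (B (1, 1)) i j).mulVec b := by
      rw [← hx, ofBD, mulVec_mulVec, hinv, one_mulVec]
    rw [this, Ex.eval_fsum, Finset.mul_sum]
    simp only [mulVec, dotProduct]
    refine Finset.sum_congr rfl fun j _ => ?_
    rw [hev, of_apply, pow_add]
    ring
  rw [hxi, ← Ex.eval_signed]
  exact hn i

end Programs

end LatticePath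
-- Conclusion with uniform constants.
theorem mainTheorem4 (n : ℕ) :
    -- strict total positivity, and the bidiagonal decomposition of `Lp_n(α, β, γ)`
    (∀ α β γ : ℝ, 0 < α → 0 < β → 0 < α * β + γ →
      LatticePath.IsSTP (LatticePath.Lp n α β γ) ∧
      LatticePath.IsBidiagonalDecomposition (LatticePath.Lp n α β γ)
        (LatticePath.latticeBD n α β γ)) ∧
    -- programs for the bidiagonal decomposition (from `α, β, γ`) and, from the computed
    -- bidiagonal decomposition, for eigenvalues, singular values, inverse and linear systems
    ∃ (P : LatticePath.Program (Fin 3) (Fin (n + 1) × Fin (n + 1)))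
      (Peig Psv : LatticePath.Program (Fin (n + 1) × Fin (n + 1)) (Fin (n + 1)))
      (Pinv : LatticePath.Program (Fin (n + 1) × Fin (n + 1)) (Fin (n + 1) × Fin (n + 1)))
      (Psolve : LatticePath.Program ((Fin (n + 1) × Fin (n + 1)) ⊕ Fin (n + 1)) (Fin (n + 1)))
      (K u₀ : ℝ),
      P.SubtractionFree ∧ 0 < K ∧ 0 < u₀ ∧
      ∀ α β γ : ℝ, 0 < α → 0 < β → 0 ≤ γ →
        -- the eigenvalues `ev`, with multiplicities, in decreasing order
        ∃ ev : Fin (n + 1) → ℝ, Antitone ev ∧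
          (LatticePath.Lp n α β γ).charpoly = ∏ i, (Polynomial.X - Polynomial.C (ev i)) ∧
          ∀ u : ℝ, 0 < u → u ≤ u₀ → ∀ F : LatticePath.FloatArith u,
            ∃ B : Fin (n + 1) × Fin (n + 1) → ℝ,
              P.Computes F ![α, β, γ] B ∧
              (∀ ij, |LatticePath.latticeBD n α β γ ij.1 ij.2 - B ij| ≤
                (K * u) * |LatticePath.latticeBD n α β γ ij.1 ij.2|) ∧
              Peig.ComputesWithin F B (K * u) ev ∧
              Psv.ComputesWithin F B (K * u)
                (fun i => (Matrix.toEuclideanLin (LatticePath.Lp n α β γ)).singularValues i) ∧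
              Pinv.ComputesWithin F B (K * u)
                (fun ij => (LatticePath.Lp n α β γ)⁻¹ ij.1 ij.2) ∧
              ∀ b x : Fin (n + 1) → ℝ, LatticePath.AlternatingSigns b →
                (LatticePath.Lp n α β γ).mulVec x = b →
                Psolve.ComputesWithin F (Sum.elim B b) (K * u) x := by
  refine ⟨fun α β γ hα hβ hq => ⟨LatticePath.isSTP_Lp n hα hβ hq,
    LatticePath.isBidiagonalDecomposition_latticeBD n hα hβ hq⟩, ?_⟩
  obtain ⟨P, E₀, hP, h₀⟩ := LatticePath.exists_near_bd n
  obtain ⟨Peig, E₁, h₁⟩ := LatticePath.exists_near_values n false E₀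
  obtain ⟨Psv, E₂, h₂⟩ := LatticePath.exists_near_values n true E₀
  obtain ⟨Pinv, E₃, h₃⟩ := LatticePath.exists_near_inverse n E₀
  obtain ⟨Psolve, E₄, h₄⟩ := LatticePath.exists_near_solve n E₀
  obtain ⟨E, hE, hE₀, hE₁, hE₂, hE₃, hE₄⟩ :
      ∃ E : ℝ, 0 < E ∧ E₀ ≤ E ∧ E₁ ≤ E ∧ E₂ ≤ E ∧ E₃ ≤ E ∧ E₄ ≤ E := by
    refine ⟨1 + |E₀| + |E₁| + |E₂| + |E₃| + |E₄|, by positivity, ?_, ?_, ?_, ?_, ?_⟩ <;>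
      linarith [le_abs_self E₀, le_abs_self E₁, le_abs_self E₂, le_abs_self E₃, le_abs_self E₄,
        abs_nonneg E₀, abs_nonneg E₁, abs_nonneg E₂, abs_nonneg E₃, abs_nonneg E₄]
  -- Returning from logarithmic to relative errors costs the factor `2` and needs `u * E ≤ 1`; the
  -- bound `1 / 100` is the one required by the counter.
  refine ⟨P, Peig, Psv, Pinv, Psolve, 2 * E, min (1 / 100) (1 / E), hP, by positivity,
    by positivity, fun α β γ hα hβ hγ => ?_⟩
  have hpos := LatticePath.posBD_latticeBD (n := n) hα hβ hγ
  have hLp := LatticePath.ofBD_latticeBD (n := n) α β γ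
  obtain ⟨d, Z, Z', hd, hd0, hZ, hA⟩ :=
    LatticePath.exists_diagonalization_Lp n hpos.left hpos.right hpos.pivot
  have hA' : LatticePath.Lp n α β γ = Z * Matrix.diagonal d * Z' := hLp.symm.trans hA
  refine ⟨d, hd, LatticePath.charpoly_eq_prod_of_diagonalization hZ hA', fun u hu huE F => ?_⟩
  have hu₁ : u ≤ 1 / 100 := huE.trans (min_le_left _ _)
  have hu₂ : u ≤ 1 / 2 := by linarith
  have huE₁ : u * E ≤ 1 := by
    have := huE.trans (min_le_right _ _)
    rwa [le_div_iff₀ hE] at this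
  have conv : ∀ {E' x y : ℝ}, E' ≤ E → LatticePath.Near (u * E') x y →
      |x - y| ≤ 2 * E * u * |x| := fun {E' x y} hE' h => by
    have := (h.mono (mul_le_mul_of_nonneg_left hE' hu.le)).abs_sub_le huE₁
    rwa [mul_assoc 2 E u, mul_comm E u]
  obtain ⟨B, hB, hBn⟩ := h₀ u hu.le hu₂ F α β γ hα hβ hγ
  refine ⟨B, hB, fun ij => conv hE₀ (hBn ij), ?_, ?_, ?_, fun b x hb hx => ?_⟩
  · obtain ⟨y, hy, hn⟩ := h₁ u hu hu₁ F _ B hBn hpos d Z Z' hd hd0 hZ hA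
    exact ⟨y, hy, fun k => conv hE₁ (hn k)⟩
  · have hdet : (LatticePath.Lp n α β γ).det ≠ 0 :=
      hLp ▸ LatticePath.det_Lp_ne_zero n hpos.left hpos.right hpos.pivot
    obtain ⟨W, hW, hWA⟩ :=
      LatticePath.exists_diagonalization_transpose_mul_self (LatticePath.Lp n α β γ)
    obtain ⟨y, hy, hn⟩ := h₂ u hu hu₁ F _ B hBn hpos _ W W.transpose
      (fun i j hij => pow_le_pow_left₀ (LinearMap.singularValues_nonneg _ _)
        (LinearMap.singularValues_antitone _ hij) 2)
      (fun i => pow_pos (LatticePath.singularValues_pos_of_det_ne_zero hdet i) 2) hW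
      (by rw [hLp]; exact hWA)
    refine ⟨y, hy, fun k => conv hE₂ ?_⟩
    have := hn k
    rwa [if_pos rfl, Real.sqrt_sq (LinearMap.singularValues_nonneg _ _)] at this
  · obtain ⟨y, hy, hn⟩ := h₃ u hu.le hu₂ F _ B hBn hpos
    exact ⟨y, hy, fun ij => conv hE₃ (hLp ▸ hn ij)⟩
  · obtain ⟨y, hy, hn⟩ := h₄ u hu.le hu₂ F _ B hBn hpos b x hb (by rw [hLp]; exact hx)
    exact ⟨y, hy, fun i => conv hE₄ (hn i)⟩
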